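/- Theorem 2.2. Let $X_1,X_2,\dots$ be i.i.d. with law $P_0$ on a measurable space $(\mathcal X,\mathcal A)$. Let $\mu$ be a $\sigma$-finite measure on $(\mathcal X,\mathcal A)$ with $P_0\ll\mu$, and let $p_0$ be a $\mu$-density of $P_0$. Let $\mathcal P$ be a set of probability measures on $(\mathcal X,\mathcal A)$, equipped with a $\sigma$-field and a semi-metric $d$ (nonnegative, symmetric, zero on the diagonal, satisfying the triangle inequality), and let every $P\in\mathcal P$ have a $\mu$-density $p$ such that $(x,P)\mapsto p(x)$ is jointly measurable. Let $\Pi$ be a probability measure on $\mathcal P$ (the prior). Write $Qf=\int f\,dQ$ and $\log 0=-\infty$, and let $$\Pi_n(B\mid X_1,\dots,X_n)=\int_B\prod_{i=1}^n p(X_i)\,d\Pi(P)\Big/\int_{\mathcal P}\prod_{i=1}^n p(X_i)\,d\Pi(P)\qquad(0/0=0)$$ denote the posterior mass of a measurable $B\subset\mathcal P$. Let $P^*\in\mathcal P$, with density $p^*$, be such that $P\mapsto d(P,P^*)$ is measurable, $-P_0\log(p^*/p_0)<\infty$, and $P_0(p/p^*)<\infty$ for all $P\in\mathcal P$. For $\varepsilon>0$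 put $$B(\varepsilon,P^*;P_0)=\Big\{P\in\mathcal P:\ -P_0\log\frac p{p^*}\le\varepsilon^2,\ P_0\Big(\log\frac p{p^*}\Big)^2\le\varepsilon^2\Big\},$$ and let $N_t(\varepsilon,\mathcal P,d;P_0,P^*)\in\{0,1,2,\dots\}\cup\{\infty\}$ be the minimal number of convex sets $B_1,\dots,B_N$ of probability measures on $(\mathcal X,\mathcal A)$ with $\mu$-densities needed to cover $\{P\in\mathcal P:\varepsilon<d(P,P^*)<2\varepsilon\}$ such that, for every $i$, $$\inf_{P\in B_i}\ \sup_{0<\alpha<1}\ -\log P_0\Big(\frac p{p^*}\Big)^\alpha\ \ge\ \frac{\varepsilon^2}4$$ ($N_t=\infty$ if there is no such finite cover). Let $\varepsilon_n>0$ satisfy $\varepsilon_n\to0$ and $\liminf_{n\to\infty}n\varepsilon_n^2>0$, and suppose that, for all integers $n,j\ge1$, $$\frac{\Pi\big(P\in\mathcal P: j\varepsilon_n<d(P,P^*)<2j\varepsilon_n\big)}{\Pi\big(B(\varepsilon_n,P^*;P_0)\big)}\le e^{n\varepsilon_n^2j^2/8}$$ (where $0/0=0$ and $a/0=\infty$ for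 $a>0$) and, for all integers $n\ge1$, $$N_t(\varepsilon,\mathcal P,d;P_0,P^*)\le e^{n\varepsilon_n^2}\qquad\text{for all }\varepsilon>\varepsilon_n.$$ Then, for every sequence $M_n\to\infty$, as $n\to\infty$, $$\Pi_n\big(P\in\mathcal P:d(P,P^*)\ge M_n\varepsilon_n\mid X_1,\dots,X_n\big)\to0\quad\text{in }L_1(P_0^n).$$ -/

import Mathlib

open MeasureTheory Filter Topology
open scoped ENNReal NNReal

noncomputable section

namespace Misspecified

/-- The integral `P f` of an extended-real-valued function: integral of the positive part minus
integral of the negative part. -/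
def extIntegral {X : Type*} [MeasurableSpace X] (P : Measure X) (f : X → EReal) : EReal :=
  ((∫⁻ x, (f x).toENNReal ∂P : ℝ≥0∞) : EReal) - ((∫⁻ x, (-(f x)).toENNReal ∂P : ℝ≥0∞) : EReal)

/-- The ratio `p / q` of the `μ`-densities of `P` and `Q`. It is only ever integrated against
a measure dominated by `μ`, so the versions of the densities are immaterial. -/
def densityRatio {X : Type*} [MeasurableSpace X] (μ P Q : Measure X) (x : X) : ℝ≥0∞ :=
  P.rnDeriv μ x / Q.rnDeriv μ x

/-- The Kullback–Leibler type neighbourhood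
`B(ε, P*; P₀) = {P ∈ 𝓜 : - P₀ log (p/p*) ≤ ε², P₀ (log (p/p*))² ≤ ε²}`, with `log 0 = -∞`.
(The second condition makes the integral in the first one absolutely convergent.) -/
def klNeighborhood {X : Type*} [MeasurableSpace X] (μ P₀ : Measure X) (𝓜 : Set (Measure X))
    (Pstar : 𝓜) (ε : ℝ) : Set 𝓜 :=
  {P | -extIntegral P₀ (fun x => ENNReal.log (densityRatio μ P Pstar x)) ≤ ((ε ^ 2 : ℝ) : EReal) ∧
    extIntegral P₀ (fun x => ENNReal.log (densityRatio μ P Pstar x) ^ 2) ≤ ((ε ^ 2 : ℝ) : EReal)}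

/-- The sets that may be used in a testing cover at level `ε`: convex sets `B` of probability
measures (having a `μ`-density `p`, as the display presupposes) such that
`inf_{P ∈ B} sup_{0 < α < 1} - log P₀ (p/p*)^α ≥ ε²/4`.
Since the model is dominated by `μ`, intersecting a convex set with the (convex) set of dominated
measures does not affect which part of the model it covers. -/
def IsTestable {X : Type*} [MeasurableSpace X] (μ P₀ Pstar : Measure X) (ε : ℝ)
    (B : Set (Measure X)) : Prop :=
  (∀ P ∈ B, IsProbabilityMeasure P ∧ P ≪ μ) ∧ Convex ℝ≥0 B ∧
    ((ε ^ 2 / 4 : ℝ) : EReal) ≤ ⨅ P ∈ B, ⨆ α ∈ Set.Ioo (0 : ℝ) 1,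
      -ENNReal.log (∫⁻ x, densityRatio μ P Pstar x ^ α ∂P₀)

/-- The covering number for testing under misspecification `N_t(ε, 𝓜, d; P₀, P*)`: the minimal
number of testable sets needed to cover `{P ∈ 𝓜 : ε < d(P, P*) < 2 ε}` (`⊤` if there is no finite
cover). The semi-metric `d` is the `dist` of the given pseudo-metric structure on `𝓜`. -/
def testingCoveringNumber {X : Type*} [MeasurableSpace X] (μ P₀ : Measure X)
    (𝓜 : Set (Measure X)) [PseudoMetricSpace 𝓜] (Pstar : 𝓜) (ε : ℝ) : ℕ∞ :=
  sInf {N : ℕ∞ | ∃ (k : ℕ) (B : Fin k → Set (Measure X)), N = k ∧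
    (∀ i, IsTestable μ P₀ Pstar ε (B i)) ∧
    ∀ P : 𝓜, ε < dist P Pstar → dist P Pstar < 2 * ε → ∃ i, (P : Measure X) ∈ B i}

/-- The posterior mass of `B` given the observations `x₁, …, xₙ`:
`∫_B ∏ p(xᵢ) dπ(P) / ∫ ∏ p(xᵢ) dπ(P)`, where `0/0 = 0`. -/
def posterior {Θ X : Type*} [MeasurableSpace Θ] (π : Measure Θ) (p : Θ → X → ℝ≥0∞) {n : ℕ}
    (x : Fin n → X) (B : Set Θ) : ℝ≥0∞ :=
  (∫⁻ P in B, ∏ i, p P (x i) ∂π) / ∫⁻ P, ∏ i, p P (x i) ∂π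

end Misspecified

end

/-!
The posterior mass of a set is at most `1`, so it is bounded by its own `a`-th power for every
`a ∈ [0, 1]`, and this power can be integrated. Write `r_P = p / p*`, so that up to a common factor
the posterior mass of `A` is `∫_A ∏ r_P(xᵢ) dπ / ∫ ∏ r_P(xᵢ) dπ`.

*Numerator.* Let `A` be the part of a shell `{η < d(P, P*) < 2η}` covered by one testable set.
Each convex combination `g` of ratios `r_P` with `P` in the testable set has an exponent `a` with
`P₀ g ^ a ≤ exp (-η² / 4)`. As `P₀ g ^ a` is convex in `a` and concave in `g`, a minimax argument
(`exists_uniform_exponent`) yields one exponent that serves all `g`. The strong law of large numbers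
and Fatou's lemma extend the bound from finite to arbitrary mixtures
(`lintegral_supportPow_mixture_le`), and peeling off one observation at a time gives
`P₀ⁿ (∫_A ∏ r_P dπ) ^ a ≤ exp (-n η² / 4) π(A) ^ a` (`lintegral_supportPow_likelihood_le`).
The exponent `a = 0` cannot be excluded; there `t ^ a` has to be read as the indicator of `t ≠ 0`,
which is the role of `supportPow`. The set `A` need not be measurable, because nothing relates the
σ-field of the model to the testable sets; its trace measure
(`exists_map_subtype_val_eq_restrict`) takes care of this.

*Denominator.* By Jensen's and Chebyshev's inequalities, `∫ ∏ r_P dπ` is at least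
`π(B(ε, P*; P₀)) exp (-(1 + C) n ε²)` outside an event of probability at most `1 / (C² n ε²)`
(`measure_evidence_lt_le`).

Summing over the covering sets and over the shells `η = j ε` with `j ≥ J` leaves the geometric tail
`∑_{j ≥ J} exp (-c j)`, where `c` is a lower bound of `n ε²` (`lintegral_posterior_le`). Letting
first `J` and then `C` grow proves the theorem.
-/

namespace Misspecified

/-! ### Powers that vanish at zero -/

section

/-- The power `t ^ a`, set to `0` at `t = 0` for every exponent. For `a > 0` this is the usual
power; for `a = 0` it is the indicator of `t ≠ 0`, which for finite `t` is the limit of `t ^ a` as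
`a` decreases to `0`, whereas `0 ^ 0 = 1` would break continuity in `a`. -/
noncomputable def supportPow (a : ℝ) (t : ℝ≥0∞) : ℝ≥0∞ := if t = 0 then 0 else t ^ a

@[simp] lemma supportPow_zero (a : ℝ) : supportPow a 0 = 0 := if_pos rfl

lemma supportPow_of_ne_zero (a : ℝ) {t : ℝ≥0∞} (ht : t ≠ 0) : supportPow a t = t ^ a := if_neg ht

lemma supportPow_eq_rpow {a : ℝ} (ha : 0 < a) (t : ℝ≥0∞) : supportPow a t = t ^ a := by
  rcases eq_or_ne t 0 with rfl | ht
  · simp [ENNReal.zero_rpow_of_pos ha]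
  · exact supportPow_of_ne_zero a ht

lemma supportPow_mul {a : ℝ} (ha : 0 ≤ a) (s t : ℝ≥0∞) :
    supportPow a (s * t) = supportPow a s * supportPow a t := by
  rcases eq_or_ne s 0 with rfl | hs
  · simp
  rcases eq_or_ne t 0 with rfl | ht
  · simp
  rw [supportPow_of_ne_zero a hs, supportPow_of_ne_zero a ht,
    supportPow_of_ne_zero a (mul_ne_zero hs ht), ENNReal.mul_rpow_of_nonneg _ _ ha]

lemma supportPow_mono {a : ℝ} (ha : 0 ≤ a) : Monotone (supportPow a) := by
  intro s t hst
  rcases eq_or_ne s 0 with rfl | hs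
  · simp
  have ht : t ≠ 0 := fun h => hs (by simpa [h] using hst)
  rw [supportPow_of_ne_zero a hs, supportPow_of_ne_zero a ht]
  exact ENNReal.rpow_le_rpow hst ha

lemma measurable_supportPow (a : ℝ) : Measurable (supportPow a) :=
  Measurable.ite (measurableSet_singleton 0) measurable_const (measurable_id.pow_const a)

lemma _root_.Measurable.supportPow {X : Type*} [MeasurableSpace X] {g : X → ℝ≥0∞}
    (hg : Measurable g) (a : ℝ) : Measurable fun x => supportPow a (g x) :=
  (measurable_supportPow a).comp hg

lemma supportPow_le_self {a : ℝ} (ha : a ≤ 1) {t : ℝ≥0∞} (ht : 1 ≤ t) : supportPow a t ≤ t := by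
  rw [supportPow_of_ne_zero a (zero_lt_one.trans_le ht).ne']
  simpa using ENNReal.rpow_le_rpow_of_exponent_le ht ha

lemma le_supportPow {a : ℝ} (ha : a ≤ 1) {t : ℝ≥0∞} (ht : t ≤ 1) : t ≤ supportPow a t := by
  rcases eq_or_ne t 0 with rfl | h
  · simp
  rw [supportPow_of_ne_zero a h]
  simpa using ENNReal.rpow_le_rpow_of_exponent_ge ht ha

lemma supportPow_le_one_add {a : ℝ} (ha₀ : 0 ≤ a) (ha₁ : a ≤ 1) (t : ℝ≥0∞) :
    supportPow a t ≤ 1 + t := by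
  rcases le_total t 1 with h | h
  · calc supportPow a t ≤ supportPow a 1 := supportPow_mono ha₀ h
      _ = 1 := by simp [supportPow_of_ne_zero a one_ne_zero]
      _ ≤ 1 + t := le_self_add
  · exact (supportPow_le_self ha₁ h).trans le_add_self

/-- Lower semicontinuity of the power, in the form that is used together with Fatou's lemma. -/
lemma supportPow_le_liminf {a : ℝ} (ha : 0 ≤ a) {u : ℕ → ℝ≥0∞} {c : ℝ≥0∞}
    (hc : c ≤ liminf u atTop) : supportPow a c ≤ liminf (fun k => supportPow a (u k)) atTop := by
  refine le_of_forall_lt fun y hy => ?_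
  have hc0 : c ≠ 0 := by rintro rfl; simp at hy
  rw [supportPow_of_ne_zero a hc0] at hy
  -- left continuity of the power function provides `b < c` whose power still exceeds `y`
  have hcont : ∀ᶠ b in 𝓝[<] c, y < b ^ a :=
    ((ENNReal.continuous_rpow_const (y := a)).tendsto c |>.mono_left nhdsWithin_le_nhds).eventually
      (lt_mem_nhds hy)
  have hpos : ∀ᶠ b in 𝓝[<] c, 0 < b :=
    Filter.Eventually.filter_mono nhdsWithin_le_nhds (lt_mem_nhds (pos_iff_ne_zero.2 hc0))
  have : (𝓝[<] c).NeBot := nhdsLT_neBot_of_exists_lt ⟨0, pos_iff_ne_zero.2 hc0⟩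
  obtain ⟨b, ⟨hyb, hb0⟩, hbc⟩ := ((hcont.and hpos).and self_mem_nhdsWithin).exists
  have hub : ∀ᶠ k in atTop, b < u k := eventually_lt_of_lt_liminf (lt_of_lt_of_le hbc hc)
  refine lt_of_lt_of_le hyb (le_liminf_of_le (by isBoundedDefault) ?_)
  filter_upwards [hub] with k hk
  rw [← supportPow_of_ne_zero a hb0.ne']
  exact supportPow_mono ha hk.le

/-- The power is convex in the exponent. -/
lemma supportPow_convex {t : ℝ≥0∞} (ht : t ≠ ∞) {a b : ℝ} (s u : ℝ≥0) (hsu : s + u = 1) :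
    supportPow (s * a + u * b) t ≤ s * supportPow a t + u * supportPow b t := by
  rcases eq_or_ne t 0 with rfl | h
  · simp
  simp only [supportPow_of_ne_zero _ h]
  lift t to ℝ≥0 using ht
  have h' : t ≠ 0 := by exact_mod_cast h
  rw [← ENNReal.coe_rpow_of_ne_zero h', ← ENNReal.coe_rpow_of_ne_zero h',
    ← ENNReal.coe_rpow_of_ne_zero h']
  norm_cast
  have := NNReal.geom_mean_le_arith_mean2_weighted s u (t ^ a) (t ^ b) hsu
  rwa [← NNReal.rpow_mul, ← NNReal.rpow_mul, ← NNReal.rpow_add h', mul_comm a, mul_comm b] at this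

lemma continuous_supportPow_exponent {t : ℝ≥0∞} (ht : t ≠ ∞) :
    Continuous fun a : ℝ => supportPow a t := by
  rcases eq_or_ne t 0 with rfl | h
  · simpa using continuous_const
  simp only [supportPow_of_ne_zero _ h]
  lift t to ℝ≥0 using ht
  have h' : t ≠ 0 := by exact_mod_cast h
  simp_rw [← ENNReal.coe_rpow_of_ne_zero h']
  refine ENNReal.continuous_coe.comp ?_
  exact continuous_iff_continuousAt.2 fun a => (NNReal.continuousAt_rpow (Or.inl h')).comp
    (f := fun a : ℝ => (t, a)) (by fun_prop)

/-- The power is concave in the base. -/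
lemma supportPow_concave {a : ℝ} (ha₀ : 0 ≤ a) (ha₁ : a ≤ 1) (x y : ℝ≥0∞) (s u : ℝ≥0)
    (hsu : s + u = 1) :
    s * supportPow a x + u * supportPow a y ≤ supportPow a (s * x + u * y) := by
  rcases eq_or_lt_of_le ha₀ with rfl | ha
  · -- the indicator of `t ≠ 0`
    have h1 : ∀ t : ℝ≥0∞, supportPow 0 t ≤ 1 := fun t => by
      unfold supportPow; split_ifs <;> simp
    by_cases h : (s : ℝ≥0∞) * x + u * y = 0
    · rw [h]
      simp only [add_eq_zero, mul_eq_zero] at h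
      rcases h with ⟨h | h, h' | h'⟩ <;> simp [h, h']
    · rw [supportPow_of_ne_zero 0 h, ENNReal.rpow_zero]
      calc (s : ℝ≥0∞) * supportPow 0 x + u * supportPow 0 y ≤ s * 1 + u * 1 := by
            gcongr <;> exact h1 _
        _ = 1 := by rw [mul_one, mul_one]; exact_mod_cast hsu
  · simp only [supportPow_eq_rpow ha]
    have key := ENNReal.rpow_arith_mean_le_arith_mean2_rpow (s : ℝ≥0∞) u (x ^ a) (y ^ a)
      (by exact_mod_cast hsu) (p := 1 / a) (by rw [le_div_iff₀ ha]; linarith)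
    rw [← ENNReal.rpow_mul, ← ENNReal.rpow_mul, mul_one_div_cancel ha.ne', ENNReal.rpow_one,
      ENNReal.rpow_one] at key
    calc _ = (((s : ℝ≥0∞) * x ^ a + u * y ^ a) ^ (1 / a)) ^ a := by
          rw [← ENNReal.rpow_mul, one_div_mul_cancel ha.ne', ENNReal.rpow_one]
      _ ≤ _ := ENNReal.rpow_le_rpow key ha.le

end

/-! ### A common exponent by convexity -/

section

/-- The two-function case of the minimax theorem: if the maximum of two convex functions exceeds `t`
everywhere on a compact interval, then so does one of their convex combinations. -/
lemma exists_convexCombination_gt {f g : ℝ → ℝ} (hf : ConvexOn ℝ (Set.Icc 0 1) f)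
    (hfc : ContinuousOn f (Set.Icc 0 1)) (hg : ConvexOn ℝ (Set.Icc 0 1) g)
    (hgc : ContinuousOn g (Set.Icc 0 1)) {t : ℝ}
    (h : ∀ x ∈ Set.Icc (0 : ℝ) 1, t < f x ⊔ g x) :
    ∃ s ∈ Set.Icc (0 : ℝ) 1, ∀ x ∈ Set.Icc (0 : ℝ) 1, t < s * f x + (1 - s) * g x := by
  refine Sion.exists_lt_iInf_of_lt_iInf_of_sup (X := Set.Icc (0 : ℝ) 1) (Y := Set.Icc (0 : ℝ) 1)
    (f := fun x s => s * f x + (1 - s) * g x) (Set.nonempty_Icc.2 zero_le_one) isCompact_Icc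
    ?_ ?_ (convex_Icc 0 1) ?_ ?_ (y1 := 1) (by simp) (y2 := 0) (by simp) (by simpa using h)
  · intro s _
    exact ((continuousOn_const.mul hfc).add (continuousOn_const.mul hgc)).lowerSemicontinuousOn
  · intro s hs
    exact ((hf.smul hs.1).add (hg.smul (sub_nonneg.2 hs.2))).quasiconvexOn
  · intro x _
    exact (Continuous.continuousOn (by fun_prop)).upperSemicontinuousOn
  · intro x _
    refine ConcaveOn.quasiconcaveOn ⟨convex_Icc 0 1, fun s _ u _ a b _ _ hab => le_of_eq ?_⟩
    simp only [smul_eq_mul]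
    linear_combination g x * hab

variable {X : Type*} [MeasurableSpace X]

lemma lintegral_supportPow_lt_top {P : Measure X} [IsProbabilityMeasure P] {g : X → ℝ≥0∞}
    (hfin : ∫⁻ x, g x ∂P ≠ ∞) {a : ℝ} (ha : a ∈ Set.Icc (0 : ℝ) 1) :
    ∫⁻ x, supportPow a (g x) ∂P < ∞ :=
  calc ∫⁻ x, supportPow a (g x) ∂P ≤ ∫⁻ x, 1 + g x ∂P :=
        lintegral_mono fun x => supportPow_le_one_add ha.1 ha.2 _
    _ = 1 + ∫⁻ x, g x ∂P := by rw [lintegral_add_left measurable_const]; simp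
    _ < ∞ := by simpa [lt_top_iff_ne_top] using hfin

lemma continuousOn_lintegral_supportPow {P : Measure X} [IsProbabilityMeasure P] {g : X → ℝ≥0∞}
    (hg : Measurable g) (hfin : ∫⁻ x, g x ∂P ≠ ∞) :
    ContinuousOn (fun a : ℝ => ∫⁻ x, supportPow a (g x) ∂P) (Set.Icc 0 1) := by
  intro a ha
  refine tendsto_lintegral_filter_of_dominated_convergence (fun x => 1 + g x) ?_ ?_ ?_ ?_
  · exact Eventually.of_forall fun b => hg.supportPow b
  · filter_upwards [self_mem_nhdsWithin] with b hb
    exact Eventually.of_forall fun x => supportPow_le_one_add hb.1 hb.2 _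
  · rw [lintegral_add_left measurable_const]
    simpa using hfin
  · filter_upwards [ae_lt_top hg hfin] with x hx
    exact (continuous_supportPow_exponent hx.ne).continuousWithinAt

lemma convexOn_lintegral_supportPow {P : Measure X} [IsProbabilityMeasure P] {g : X → ℝ≥0∞}
    (hg : Measurable g) (hfin : ∫⁻ x, g x ∂P ≠ ∞) :
    ConvexOn ℝ (Set.Icc 0 1) (fun a : ℝ => (∫⁻ x, supportPow a (g x) ∂P).toReal) := by
  refine ⟨convex_Icc 0 1, fun a ha b hb s u hs hu hsu => ?_⟩
  lift s to ℝ≥0 using hs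
  lift u to ℝ≥0 using hu
  have hA := (lintegral_supportPow_lt_top hfin ha).ne
  have hB := (lintegral_supportPow_lt_top hfin hb).ne
  have key : ∫⁻ x, supportPow (s * a + u * b) (g x) ∂P
      ≤ s * ∫⁻ x, supportPow a (g x) ∂P + u * ∫⁻ x, supportPow b (g x) ∂P := by
    rw [← lintegral_const_mul _ (hg.supportPow a),
      ← lintegral_const_mul _ (hg.supportPow b),
      ← lintegral_add_left ((hg.supportPow a).const_mul _)]
    refine lintegral_mono_ae ?_
    filter_upwards [ae_lt_top hg hfin] with x hx
    exact supportPow_convex hx.ne s u (by exact_mod_cast hsu)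
  have := ENNReal.toReal_mono (by finiteness) key
  rw [ENNReal.toReal_add (by finiteness) (by finiteness), ENNReal.toReal_mul,
    ENNReal.toReal_mul] at this
  simpa using this

/-- If every member of a convex family of functions has an exponent at which its fractional moment is
at most `v`, then one exponent serves the whole family. The exponents that serve `g` form a compact
interval; any two of these intervals meet by `exists_convexCombination_gt`, hence all of them do by
Helly's theorem on the line. -/
lemma exists_uniform_exponent {P : Measure X} [IsProbabilityMeasure P] {𝓖 : Set (X → ℝ≥0∞)}
    (hmeas : ∀ g ∈ 𝓖, Measurable g) (hfin : ∀ g ∈ 𝓖, ∫⁻ x, g x ∂P ≠ ∞)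
    (hconv : ∀ g ∈ 𝓖, ∀ h ∈ 𝓖, ∀ s u : ℝ≥0, s + u = 1 →
      (fun x => (s : ℝ≥0∞) * g x + u * h x) ∈ 𝓖) {v : ℝ≥0} 
    (hv : ∀ g ∈ 𝓖, ∃ a ∈ Set.Icc (0 : ℝ) 1, ∫⁻ x, supportPow a (g x) ∂P ≤ v) :
    ∃ a ∈ Set.Icc (0 : ℝ) 1, ∀ g ∈ 𝓖, ∫⁻ x, supportPow a (g x) ∂P ≤ v := by
  -- the real-valued moment function of `g`
  let m : (X → ℝ≥0∞) → ℝ → ℝ := fun g a => (∫⁻ x, supportPow a (g x) ∂P).toReal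
  have hm : ∀ g ∈ 𝓖, ∀ a ∈ Set.Icc (0 : ℝ) 1,
      (∫⁻ x, supportPow a (g x) ∂P ≤ v ↔ m g a ≤ v) := fun g hg a ha => by
    rw [← ENNReal.coe_toReal v, ENNReal.toReal_le_toReal
      (lintegral_supportPow_lt_top (hfin g hg) ha).ne ENNReal.coe_ne_top]
  have hcvx : ∀ g ∈ 𝓖, ConvexOn ℝ (Set.Icc 0 1) (m g) := fun g hg =>
    convexOn_lintegral_supportPow (hmeas g hg) (hfin g hg)
  have hcont : ∀ g ∈ 𝓖, ContinuousOn (m g) (Set.Icc 0 1) := fun g hg a ha =>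
    (ENNReal.tendsto_toReal (lintegral_supportPow_lt_top (hfin g hg) ha).ne).comp
      (continuousOn_lintegral_supportPow (hmeas g hg) (hfin g hg) a ha)
  let I : 𝓖 → Set ℝ := fun g => {a ∈ Set.Icc (0 : ℝ) 1 | m g a ≤ v}
  have hpair : ∀ g h : 𝓖, (I g ∩ I h).Nonempty := by
    intro g h
    by_contra hne
    rw [Set.not_nonempty_iff_eq_empty] at hne
    obtain ⟨s, hs, hgt⟩ := exists_convexCombination_gt (hcvx g g.2) (hcont g g.2) (hcvx h h.2)
      (hcont h h.2) (t := v) fun a ha => by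
        by_contra hle
        rw [not_lt, sup_le_iff] at hle
        have : a ∈ I g ∩ I h := ⟨⟨ha, hle.1⟩, ⟨ha, hle.2⟩⟩
        simp [hne] at this
    lift s to ℝ≥0 using hs.1
    have hs1 : s ≤ 1 := by exact_mod_cast hs.2
    have hsu : s + (1 - s) = 1 := add_tsub_cancel_of_le hs1
    have hmem := hconv g g.2 h h.2 s (1 - s) hsu
    obtain ⟨a, ha, hav⟩ := hv _ hmem
    refine (hgt a ha).not_ge ?_
    refine le_trans ?_ ((hm _ hmem a ha).1 hav)
    have hG := (lintegral_supportPow_lt_top (hfin g g.2) ha).ne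
    have hH := (lintegral_supportPow_lt_top (hfin h h.2) ha).ne
    have key : s * ∫⁻ x, supportPow a (g.1 x) ∂P + ((1 - s : ℝ≥0) : ℝ≥0∞) *
        ∫⁻ x, supportPow a (h.1 x) ∂P ≤
        ∫⁻ x, supportPow a (s * g.1 x + ((1 - s : ℝ≥0) : ℝ≥0∞) * h.1 x) ∂P := by
      rw [← lintegral_const_mul _ ((hmeas g g.2).supportPow a),
        ← lintegral_const_mul _ ((hmeas h h.2).supportPow a),
        ← lintegral_add_left (((hmeas g g.2).supportPow a).const_mul _)]
      exact lintegral_mono fun x => supportPow_concave ha.1 ha.2 _ _ _ _ hsu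
    have := ENNReal.toReal_mono (lintegral_supportPow_lt_top (hfin _ hmem) ha).ne key
    rw [ENNReal.toReal_add (by finiteness) (by finiteness), ENNReal.toReal_mul,
      ENNReal.toReal_mul, ENNReal.coe_toReal, ENNReal.coe_toReal, NNReal.coe_sub hs1] at this
    exact this
  rcases 𝓖.eq_empty_or_nonempty with h𝓖 | ⟨g₀, hg₀⟩
  · exact ⟨0, by simp, by simp [h𝓖]⟩
  -- compact intervals that meet pairwise have a common point
  have hhelly : (⋂ g, I g).Nonempty := by
    refine Convex.helly_theorem_compact' (𝕜 := ℝ) (F := I) (fun g => (hcvx g g.2).convex_le v)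
      (fun g => ?_) fun J hJ => ?_
    · exact isCompact_Icc.of_isClosed_subset ((hcont g g.2).preimage_isClosed_of_isClosed
        isClosed_Icc isClosed_Iic) fun a ha => ha.1
    · classical
      rcases J.eq_empty_or_nonempty with rfl | ⟨g, hg⟩
      · simp
      have hcard : (J.erase g).card ≤ 1 := by
        rw [Finset.card_erase_of_mem hg]
        simp only [Module.finrank_self] at hJ
        omega
      have : Nonempty 𝓖 := ⟨g⟩
      obtain ⟨h, hh⟩ := Finset.card_le_one_iff_subset_singleton.1 hcard
      obtain ⟨a, hag, hah⟩ := hpair g h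
      refine ⟨a, Set.mem_iInter₂.2 fun k hk => ?_⟩
      by_cases hkg : k = g
      · exact hkg ▸ hag
      · have := hh (Finset.mem_erase.2 ⟨hkg, hk⟩)
        rw [Finset.mem_singleton] at this
        exact this ▸ hah
  obtain ⟨a, ha⟩ := hhelly
  rw [Set.mem_iInter] at ha
  have ha01 := (ha ⟨g₀, hg₀⟩).1
  exact ⟨a, ha01, fun g hg => (hm g hg a ha01).2 (ha ⟨g, hg⟩).2⟩

end

/-! ### Mixtures and product likelihoods -/

section

variable {X Θ : Type*} [MeasurableSpace X] [MeasurableSpace Θ]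

/-- One half of the strong law of large numbers for nonnegative functions, without integrability. -/
lemma lintegral_le_liminf_average {ν : Measure Θ} [IsProbabilityMeasure ν] {f : Θ → ℝ≥0∞}
    (hf : Measurable f) :
    ∀ᵐ ω ∂(Measure.infinitePi fun _ : ℕ => ν),
      ∫⁻ θ, f θ ∂ν ≤ liminf (fun k : ℕ => (∑ i ∈ Finset.range k, f (ω i)) / k) atTop := by
  -- apply the strong law to the bounded truncations of `f`
  have hfin : ∀ (N : ℕ) θ, min (f θ) N ≠ ∞ := fun N θ =>
    ((min_le_right _ _).trans_lt (ENNReal.natCast_lt_top N)).ne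
  have hmeasN : ∀ N : ℕ, Measurable fun θ => (min (f θ) N).toReal := fun N =>
    (hf.min measurable_const).ennreal_toReal
  have hbound : ∀ (N : ℕ) θ, ‖(min (f θ) N).toReal‖ ≤ N := fun N θ => by
    rw [Real.norm_of_nonneg ENNReal.toReal_nonneg]
    simpa using ENNReal.toReal_mono (ENNReal.natCast_ne_top N) (min_le_right (f θ) N)
  have hlln : ∀ N : ℕ, ∀ᵐ ω ∂(Measure.infinitePi fun _ : ℕ => ν),
      Tendsto (fun k : ℕ => (∑ i ∈ Finset.range k, (min (f (ω i)) N).toReal) / k) atTop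
        (𝓝 (∫ θ, (min (f θ) N).toReal ∂ν)) := by
    intro N
    have hmp := fun i : ℕ => measurePreserving_eval_infinitePi (fun _ : ℕ => ν) i
    have := ProbabilityTheory.strong_law_ae_real (μ := Measure.infinitePi fun _ : ℕ => ν)
      (fun i ω => (min (f (ω i)) N).toReal)
      (Integrable.of_bound ((hmeasN N).comp (measurable_pi_apply 0)).aestronglyMeasurable N
        (Eventually.of_forall fun ω => hbound N (ω 0)))
      (fun i j hij => (ProbabilityTheory.iIndepFun_infinitePi (P := fun _ : ℕ => ν)
        (X := fun _ θ => (min (f θ) N).toReal) (fun _ => hmeasN N)).indepFun hij)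
      (fun i => ProbabilityTheory.IdentDistrib.mk
        ((hmeasN N).comp (measurable_pi_apply i)).aemeasurable
        ((hmeasN N).comp (measurable_pi_apply 0)).aemeasurable (by
          have h : ∀ j : ℕ, Measure.map (fun ω : ℕ → Θ => (min (f (ω j)) N).toReal)
              (Measure.infinitePi fun _ : ℕ => ν) = Measure.map (fun θ => (min (f θ) N).toReal) ν :=
            fun j => by
              conv_rhs => rw [← (hmp j).map_eq, Measure.map_map (hmeasN N) (measurable_pi_apply j)]
              rfl
          rw [h i, h 0]))
    have hint : (∫ ω, (min (f (ω 0)) N).toReal ∂(Measure.infinitePi fun _ : ℕ => ν))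
        = ∫ θ, (min (f θ) N).toReal ∂ν := by
      conv_rhs => rw [← (hmp 0).map_eq]
      rw [integral_map (hmp 0).measurable.aemeasurable (hmeasN N).aestronglyMeasurable]
    rwa [hint] at this
  filter_upwards [ae_all_iff.2 hlln] with ω hω
  have hsup : ∫⁻ θ, f θ ∂ν = ⨆ N : ℕ, ∫⁻ θ, min (f θ) N ∂ν := by
    rw [← lintegral_iSup (fun N => hf.min measurable_const)
      (fun N M hNM θ => min_le_min_left _ (by exact_mod_cast hNM))]
    congr with θ
    refine le_antisymm ?_ (iSup_le fun N => min_le_left _ _)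
    refine le_of_forall_lt fun y hy => ?_
    obtain ⟨N, hN⟩ := ENNReal.exists_nat_gt hy.ne_top
    exact (lt_min hy hN).trans_le (le_iSup (fun N : ℕ => min (f θ) N) N)
  rw [hsup]
  refine iSup_le fun N => ?_
  have hlim : Tendsto (fun k : ℕ => (∑ i ∈ Finset.range k, min (f (ω i)) N) / k) atTop
      (𝓝 (∫⁻ θ, min (f θ) N ∂ν)) := by
    have h1 := ENNReal.tendsto_ofReal (hω N)
    have h2 : ENNReal.ofReal (∫ θ, (min (f θ) N).toReal ∂ν) = ∫⁻ θ, min (f θ) N ∂ν := by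
      rw [ofReal_integral_eq_lintegral_ofReal (Integrable.of_bound
        (hmeasN N).aestronglyMeasurable N (Eventually.of_forall (hbound N)))
        (Eventually.of_forall fun θ => ENNReal.toReal_nonneg)]
      simp_rw [ENNReal.ofReal_toReal (hfin N _)]
    rw [h2] at h1
    refine h1.congr' ?_
    filter_upwards [eventually_gt_atTop 0] with k hk
    rw [ENNReal.ofReal_div_of_pos (by exact_mod_cast hk), ENNReal.ofReal_natCast,
      ENNReal.ofReal_sum_of_nonneg fun i _ => ENNReal.toReal_nonneg]
    simp_rw [ENNReal.ofReal_toReal (hfin N _)]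
  rw [← hlim.liminf_eq]
  refine liminf_le_liminf (Eventually.of_forall fun k => ?_) (by isBoundedDefault)
    (by isBoundedDefault)
  gcongr
  exact min_le_left _ _

lemma average_mem {Y : Type*} {𝓖 : Set (Y → ℝ≥0∞)}
    (hconv : ∀ g ∈ 𝓖, ∀ h ∈ 𝓖, ∀ s u : ℝ≥0, s + u = 1 →
      (fun x => (s : ℝ≥0∞) * g x + u * h x) ∈ 𝓖)
    {g : ℕ → Y → ℝ≥0∞} (hg : ∀ i, g i ∈ 𝓖) (k : ℕ) :
    (fun x => (∑ i ∈ Finset.range (k + 1), g i x) / ((k + 1 : ℕ) : ℝ≥0∞)) ∈ 𝓖 := by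
  induction k with
  | zero => simpa using hg 0
  | succ k ih =>
    have hpos : ((k : ℝ≥0) + 2) ≠ 0 := by positivity
    convert hconv _ ih _ (hg (k + 1)) ((k + 1) / (k + 2)) (1 / (k + 2))
      (by field_simp; ring) using 2 with x
    rw [Finset.sum_range_succ _ (k + 1), ENNReal.coe_div hpos, ENNReal.coe_div hpos]
    simp only [div_eq_mul_inv, add_mul]
    push_cast
    have h1 : ((k : ℝ≥0∞) + 1) * ((k : ℝ≥0∞) + 1)⁻¹ = 1 :=
      ENNReal.mul_inv_cancel (by simp) (by finiteness)
    have h2 : (k : ℝ≥0∞) + 1 + 1 = k + 2 := by rw [add_assoc, one_add_one_eq_two]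
    rw [h2, one_mul]
    congr 1
    · calc _ = (((k : ℝ≥0∞) + 1) * ((k : ℝ≥0∞) + 1)⁻¹) *
            ((∑ i ∈ Finset.range (k + 1), g i x) * ((k : ℝ≥0∞) + 2)⁻¹) := by rw [h1, one_mul]
        _ = _ := by ring
    · ring

/-- A bound on the fractional moment over a convex family passes to arbitrary mixtures: for almost
every sample from the mixing measure, the mixture lies below the lower limit of finite averages. -/
lemma lintegral_supportPow_mixture_le_of_isProbabilityMeasure {P : Measure X}
    [IsProbabilityMeasure P] {𝓖 : Set (X → ℝ≥0∞)}
    (hconv : ∀ g ∈ 𝓖, ∀ h ∈ 𝓖, ∀ s u : ℝ≥0, s + u = 1 →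
      (fun x => (s : ℝ≥0∞) * g x + u * h x) ∈ 𝓖)
    {a : ℝ} (ha : 0 ≤ a) {v : ℝ≥0∞} (hv : ∀ g ∈ 𝓖, ∫⁻ x, supportPow a (g x) ∂P ≤ v)
    {r : Θ → X → ℝ≥0∞} (hr : Measurable (Function.uncurry r)) (hr𝓖 : ∀ θ, r θ ∈ 𝓖)
    (ν : Measure Θ) [IsProbabilityMeasure ν] :
    ∫⁻ x, supportPow a (∫⁻ θ, r θ x ∂ν) ∂P ≤ v := by
  have hmeas : ∀ k : ℕ, Measurable fun z : (ℕ → Θ) × X =>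
      (∑ i ∈ Finset.range k, r (z.1 i) z.2) / (k : ℝ≥0∞) := fun k =>
    (Finset.measurable_sum _ fun i _ => hr.comp
      (((measurable_pi_apply i).comp measurable_fst).prodMk measurable_snd)).div_const _
  have hae : ∀ᵐ ω ∂(Measure.infinitePi fun _ : ℕ => ν), ∀ᵐ x ∂P, ∫⁻ θ, r θ x ∂ν ≤
      liminf (fun k : ℕ => (∑ i ∈ Finset.range k, r (ω i) x) / (k : ℝ≥0∞)) atTop := by
    rw [Measure.ae_ae_comm]
    · exact Eventually.of_forall fun x =>
        lintegral_le_liminf_average (hr.comp measurable_prodMk_right)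
    · exact measurableSet_le
        ((Measurable.lintegral_prod_left' (f := fun z : Θ × X => r z.1 z.2) hr).comp measurable_snd)
        (Measurable.liminf hmeas)
  obtain ⟨ω, hω⟩ := hae.exists
  calc ∫⁻ x, supportPow a (∫⁻ θ, r θ x ∂ν) ∂P
      ≤ ∫⁻ x, liminf (fun k : ℕ => supportPow a
          ((∑ i ∈ Finset.range k, r (ω i) x) / (k : ℝ≥0∞))) atTop ∂P := by
        refine lintegral_mono_ae ?_
        filter_upwards [hω] with x hx
        exact supportPow_le_liminf ha hx
    _ ≤ liminf (fun k : ℕ => ∫⁻ x, supportPow a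
          ((∑ i ∈ Finset.range k, r (ω i) x) / (k : ℝ≥0∞)) ∂P) atTop :=
        lintegral_liminf_le fun k =>
          ((hmeas k).comp measurable_prodMk_left : Measurable _).supportPow a
    _ ≤ v := by
        refine liminf_le_of_frequently_le' (Eventually.frequently ?_)
        filter_upwards [eventually_gt_atTop 0] with k hk
        obtain ⟨k, rfl⟩ := Nat.exists_eq_succ_of_ne_zero hk.ne'
        exact hv _ (average_mem hconv (fun i => hr𝓖 (ω i)) k)

/-- The mixture bound for the mixing measure `h dν`, whose mass is allowed to be infinite. This is
needed since the likelihood of the other observations will play the role of `h`. -/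
lemma lintegral_supportPow_mixture_le {P : Measure X} [IsProbabilityMeasure P]
    {𝓖 : Set (X → ℝ≥0∞)}
    (hconv : ∀ g ∈ 𝓖, ∀ h ∈ 𝓖, ∀ s u : ℝ≥0, s + u = 1 →
      (fun x => (s : ℝ≥0∞) * g x + u * h x) ∈ 𝓖)
    {a : ℝ} (ha : 0 ≤ a) {v : ℝ≥0∞} (hv : ∀ g ∈ 𝓖, ∫⁻ x, supportPow a (g x) ∂P ≤ v)
    {r : Θ → X → ℝ≥0∞} (hr : Measurable (Function.uncurry r)) (hr𝓖 : ∀ θ, r θ ∈ 𝓖)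
    (ν : Measure Θ) [IsFiniteMeasure ν] {h : Θ → ℝ≥0∞} (hh : Measurable h) :
    ∫⁻ x, supportPow a (∫⁻ θ, r θ x * h θ ∂ν) ∂P ≤ v * supportPow a (∫⁻ θ, h θ ∂ν) := by
  have hrx : ∀ x, Measurable fun θ => r θ x := fun x => hr.comp measurable_prodMk_right
  have hsup : ∀ θ, ⨆ N : ℕ, min (h θ) N = h θ := fun θ => by
    refine le_antisymm (iSup_le fun N => min_le_left _ _) (le_of_forall_lt fun y hy => ?_)
    obtain ⟨N, hN⟩ := ENNReal.exists_nat_gt hy.ne_top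
    exact (lt_min hy hN).trans_le (le_iSup (fun N : ℕ => min (h θ) N) N)
  have hmin : ∀ N : ℕ, Measurable fun θ => min (h θ) N := fun N => hh.min measurable_const
  have hlim : ∀ x, Tendsto (fun N : ℕ => ∫⁻ θ, r θ x * min (h θ) N ∂ν) atTop
      (𝓝 (∫⁻ θ, r θ x * h θ ∂ν)) := fun x => by
    have hmono : Monotone fun (N : ℕ) θ => r θ x * min (h θ) N := fun N M hNM θ =>
      mul_le_mul_right (min_le_min_left _ (by exact_mod_cast hNM)) _
    have : ∫⁻ θ, r θ x * h θ ∂ν = ⨆ N : ℕ, ∫⁻ θ, r θ x * min (h θ) N ∂ν := by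
      rw [← lintegral_iSup (f := fun (N : ℕ) θ => r θ x * min (h θ) N)
        (fun N => (hrx x).mul (hmin N)) hmono]
      simp_rw [← ENNReal.mul_iSup, hsup]
    rw [this]
    exact tendsto_atTop_iSup fun N M hNM => lintegral_mono (hmono hNM)
  have hN : ∀ N : ℕ, ∫⁻ x, supportPow a (∫⁻ θ, r θ x * min (h θ) N ∂ν) ∂P
      ≤ v * supportPow a (∫⁻ θ, h θ ∂ν) := by
    intro N
    set m := ∫⁻ θ, min (h θ) N ∂ν with hm
    have hle : m ≤ ∫⁻ θ, h θ ∂ν := lintegral_mono fun θ => min_le_left _ _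
    have hmtop : m ≠ ∞ := by
      refine ne_top_of_le_ne_top ?_ (lintegral_mono (g := fun _ => (N : ℝ≥0∞))
        fun θ => min_le_right (h θ) _)
      simp only [lintegral_const]
      finiteness
    rcases eq_or_ne m 0 with hm0 | hm0
    · have h0 : ∀ x, ∫⁻ θ, r θ x * min (h θ) N ∂ν = 0 := fun x => by
        rw [hm, lintegral_eq_zero_iff (hmin N)] at hm0
        refine lintegral_eq_zero_of_ae_eq_zero ?_
        filter_upwards [hm0] with θ hθ
        simp only [Pi.zero_apply] at hθ ⊢
        rw [hθ, mul_zero]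
      simp [h0]
    · let ν' := m⁻¹ • ν.withDensity fun θ => min (h θ) N
      have : IsProbabilityMeasure ν' := ⟨by
        simp only [ν', Measure.smul_apply, withDensity_apply _ MeasurableSet.univ,
          Measure.restrict_univ, smul_eq_mul]
        exact ENNReal.inv_mul_cancel hm0 hmtop⟩
      have heq : ∀ x, ∫⁻ θ, r θ x * min (h θ) N ∂ν = m * ∫⁻ θ, r θ x ∂ν' := fun x => by
        simp only [ν', lintegral_smul_measure, smul_eq_mul]
        rw [← mul_assoc, ENNReal.mul_inv_cancel hm0 hmtop, one_mul,
          lintegral_withDensity_eq_lintegral_mul _ (hmin N) (hrx x)]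
        simp [mul_comm]
      simp_rw [heq, supportPow_mul ha]
      rw [lintegral_const_mul _ (Measurable.supportPow (Measurable.lintegral_prod_left'
        (f := fun z : Θ × X => r z.1 z.2) hr) a), mul_comm]
      exact mul_le_mul' (lintegral_supportPow_mixture_le_of_isProbabilityMeasure hconv ha hv hr
        hr𝓖 ν') (supportPow_mono ha hle)
  calc ∫⁻ x, supportPow a (∫⁻ θ, r θ x * h θ ∂ν) ∂P
      ≤ ∫⁻ x, liminf (fun N : ℕ => supportPow a (∫⁻ θ, r θ x * min (h θ) N ∂ν)) atTop ∂P :=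
        lintegral_mono fun x => supportPow_le_liminf ha (hlim x).liminf_eq.ge
    _ ≤ liminf (fun N : ℕ => ∫⁻ x, supportPow a (∫⁻ θ, r θ x * min (h θ) N ∂ν) ∂P) atTop :=
        lintegral_liminf_le fun N => Measurable.supportPow (Measurable.lintegral_prod_left'
          (f := fun z : Θ × X => r z.1 z.2 * min (h z.1) N)
          (hr.mul ((hmin N).comp measurable_fst))) a
    _ ≤ v * supportPow a (∫⁻ θ, h θ ∂ν) :=
        liminf_le_of_frequently_le' (Eventually.frequently (Eventually.of_forall hN))

lemma lintegral_pi_succ {P : Measure X} [IsProbabilityMeasure P] {n : ℕ}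
    {f : (Fin (n + 1) → X) → ℝ≥0∞} (hf : Measurable f) :
    ∫⁻ x, f x ∂(Measure.pi fun _ : Fin (n + 1) => P) =
      ∫⁻ y, ∫⁻ x, f (Fin.cons y x) ∂(Measure.pi fun _ : Fin n => P) ∂P := by
  have hmp := (measurePreserving_piFinSuccAbove (fun _ : Fin (n + 1) => P) 0).symm
  rw [← hmp.lintegral_comp hf]
  rw [lintegral_prod (fun z => f ((MeasurableEquiv.piFinSuccAbove (fun _ => X) 0).symm z))
    (hf.comp (MeasurableEquiv.measurable _)).aemeasurable]
  simp [MeasurableEquiv.piFinSuccAbove, Fin.insertNthEquiv]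

lemma measurable_prod_apply {r : Θ → X → ℝ≥0∞} (hr : Measurable (Function.uncurry r)) (n : ℕ) :
    Measurable fun z : Θ × (Fin n → X) => ∏ i, r z.1 (z.2 i) :=
  Finset.measurable_prod _ fun i _ => hr.comp
    (measurable_fst.prodMk ((measurable_pi_apply i).comp measurable_snd))

/-- The fractional moment of a mixed likelihood decreases geometrically in the number of
observations. Integrating out the first observation is an instance of the mixture bound. -/
lemma lintegral_supportPow_likelihood_le {P : Measure X} [IsProbabilityMeasure P]
    {𝓖 : Set (X → ℝ≥0∞)}
    (hconv : ∀ g ∈ 𝓖, ∀ h ∈ 𝓖, ∀ s u : ℝ≥0, s + u = 1 →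
      (fun x => (s : ℝ≥0∞) * g x + u * h x) ∈ 𝓖)
    {a : ℝ} (ha : 0 ≤ a) {v : ℝ≥0∞} (hv : ∀ g ∈ 𝓖, ∫⁻ x, supportPow a (g x) ∂P ≤ v)
    {r : Θ → X → ℝ≥0∞} (hr : Measurable (Function.uncurry r)) (hr𝓖 : ∀ θ, r θ ∈ 𝓖)
    (ν : Measure Θ) [IsFiniteMeasure ν] (n : ℕ) {h : Θ → ℝ≥0∞} (hh : Measurable h) :
    ∫⁻ x, supportPow a (∫⁻ θ, (∏ i, r θ (x i)) * h θ ∂ν) ∂(Measure.pi fun _ : Fin n => P)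
      ≤ v ^ n * supportPow a (∫⁻ θ, h θ ∂ν) := by
  induction n generalizing h with
  | zero => simp
  | succ n ih =>
    have hmeas : ∀ n : ℕ, Measurable fun x : Fin n → X =>
        supportPow a (∫⁻ θ, (∏ i, r θ (x i)) * h θ ∂ν) := fun n =>
      Measurable.supportPow (Measurable.lintegral_prod_left'
        (f := fun z : Θ × (Fin n → X) => (∏ i, r z.1 (z.2 i)) * h z.1)
        ((measurable_prod_apply hr n).mul (hh.comp measurable_fst))) a
    rw [lintegral_pi_succ (hmeas _)]
    calc _ ≤ ∫⁻ y, v ^ n * supportPow a (∫⁻ θ, r θ y * h θ ∂ν) ∂P := by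
          refine lintegral_mono fun y => ?_
          refine le_trans (le_of_eq ?_) (ih ((hr.comp measurable_prodMk_right :
            Measurable fun θ => r θ y).mul hh))
          simp only [Fin.prod_univ_succ, Fin.cons_zero, Fin.cons_succ]
          refine lintegral_congr fun x => ?_
          congr 1
          exact lintegral_congr fun θ => by ring
      _ = v ^ n * ∫⁻ y, supportPow a (∫⁻ θ, r θ y * h θ ∂ν) ∂P :=
          lintegral_const_mul _ (Measurable.supportPow (Measurable.lintegral_prod_left'
            (f := fun z : Θ × X => r z.1 z.2 * h z.1) (hr.mul (hh.comp measurable_fst))) a)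
      _ ≤ v ^ n * (v * supportPow a (∫⁻ θ, h θ ∂ν)) := by
          gcongr
          exact lintegral_supportPow_mixture_le hconv ha hv hr hr𝓖 ν hh
      _ = v ^ (n + 1) * supportPow a (∫⁻ θ, h θ ∂ν) := by ring

/-- The trace of a measure on a set that need not be measurable. -/
lemma exists_map_subtype_val_eq_restrict (π : Measure Θ) (A : Set Θ) :
    ∃ τ : Measure A, τ.map Subtype.val = π.restrict A := by
  have hle : (inferInstance : MeasurableSpace A) ≤
      (OuterMeasure.comap Subtype.val π.toOuterMeasure : OuterMeasure A).caratheodory := by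
    rintro _ ⟨T, hT, rfl⟩
    rw [OuterMeasure.isCaratheodory_iff]
    intro s
    simp only [OuterMeasure.comap_apply, Measure.coe_toOuterMeasure]
    rw [Set.sdiff_eq, ← Set.preimage_compl, Set.image_inter_preimage, Set.image_inter_preimage,
      ← Set.sdiff_eq, measure_inter_add_sdiff _ hT]
  refine ⟨OuterMeasure.toMeasure _ hle, Measure.ext fun T hT => ?_⟩
  rw [Measure.map_apply measurable_subtype_coe hT,
    toMeasure_apply _ _ (measurable_subtype_coe hT), Measure.restrict_apply hT,
    OuterMeasure.comap_apply, Subtype.image_preimage_coe, Set.inter_comm]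
  rfl

end

/-! ### The lower bound on the evidence -/

section

variable {X Θ : Type*} [MeasurableSpace X] [MeasurableSpace Θ]

/-- Jensen's inequality for `exp`, with both sides in `ℝ≥0∞` so that `exp ∘ g` need not be
integrable. -/
lemma ofReal_exp_integral_le {ν : Measure Θ} [IsProbabilityMeasure ν] {g : Θ → ℝ}
    (hg : Integrable g ν) :
    ENNReal.ofReal (Real.exp (∫ θ, g θ ∂ν)) ≤ ∫⁻ θ, ENNReal.ofReal (Real.exp (g θ)) ∂ν := by
  -- integrate the tangent of `exp` at the mean
  set a := ∫ θ, g θ ∂ν with ha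
  have hint : Integrable (fun θ => Real.exp a * (1 + (g θ - a))) ν :=
    ((integrable_const _).add (hg.sub (integrable_const _))).const_mul _
  have heq : ∫ θ, Real.exp a * (1 + (g θ - a)) ∂ν = Real.exp a := by
    rw [integral_const_mul, integral_add (f := fun _ => (1 : ℝ)) (g := fun θ => g θ - a)
      (integrable_const _) (hg.sub (integrable_const _)), integral_sub hg (integrable_const _)]
    simp [← ha]
  calc ENNReal.ofReal (Real.exp a) = ENNReal.ofReal (∫ θ, Real.exp a * (1 + (g θ - a)) ∂ν) := by
        rw [heq]
    _ ≤ ∫⁻ θ, ENNReal.ofReal (Real.exp a * (1 + (g θ - a))) ∂ν := by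
        refine ENNReal.ofReal_le_of_le_toReal ?_
        rw [integral_eq_lintegral_pos_part_sub_lintegral_neg_part hint]
        exact sub_le_self _ ENNReal.toReal_nonneg
    _ ≤ ∫⁻ θ, ENNReal.ofReal (Real.exp (g θ)) ∂ν := by
        refine lintegral_mono fun θ => ENNReal.ofReal_le_ofReal ?_
        calc Real.exp a * (1 + (g θ - a)) ≤ Real.exp a * Real.exp (g θ - a) := by
              gcongr
              linarith [Real.add_one_le_exp (g θ - a)]
          _ = Real.exp (g θ) := by rw [← Real.exp_add]; ring_nf

lemma ae_forall_apply {P : Measure X} [IsProbabilityMeasure P] {q : X → Prop}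
    (h : ∀ᵐ x ∂P, q x) (n : ℕ) : ∀ᵐ x ∂(Measure.pi fun _ : Fin n => P), ∀ i, q (x i) :=
  ae_all_iff.2 fun i =>
    (measurePreserving_eval (fun _ : Fin n => P) i).quasiMeasurePreserving.ae h

/-- Chebyshev's inequality for a sum of independent copies of `Z`. -/
lemma measure_sum_lt_le {P : Measure X} [IsProbabilityMeasure P] {Z : X → ℝ} (hZ : MemLp Z 2 P)
    {ε : ℝ} (hε : 0 < ε) (hmean : -ε ^ 2 ≤ ∫ x, Z x ∂P) (hsq : ∫ x, Z x ^ 2 ∂P ≤ ε ^ 2)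
    {n : ℕ} (hn : 0 < n) {C : ℝ} (hC : 0 < C) :
    (Measure.pi fun _ : Fin n => P) {x | ∑ i, Z (x i) < -((1 + C) * (n * ε ^ 2))}
      ≤ ENNReal.ofReal (1 / (C ^ 2 * (n * ε ^ 2))) := by
  have hn' : (0 : ℝ) < n := by exact_mod_cast hn
  have hc : 0 < C * (n * ε ^ 2) := by positivity
  have hZi : ∀ i : Fin n, MemLp (fun x : Fin n → X => Z (x i)) 2 (Measure.pi fun _ => P) :=
    fun i => hZ.comp_measurePreserving (measurePreserving_eval (fun _ : Fin n => P) i)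
  have hS : MemLp (∑ i, fun x : Fin n → X => Z (x i)) 2 (Measure.pi fun _ => P) :=
    memLp_finsetSum' _ fun i _ => hZi i
  have hvar : ProbabilityTheory.variance (∑ i, fun x : Fin n → X => Z (x i))
      (Measure.pi fun _ => P) ≤ n * ε ^ 2 := by
    rw [ProbabilityTheory.variance_sum_pi (μ := fun _ : Fin n => P) (X := fun _ => Z)
      fun _ => hZ]
    simp only [Finset.sum_const, Finset.card_univ, Fintype.card_fin, nsmul_eq_mul]
    gcongr
    exact (ProbabilityTheory.variance_le_expectation_sq hZ.aestronglyMeasurable).trans hsq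
  have hES : ∫ x, (∑ i, fun x : Fin n → X => Z (x i)) x ∂(Measure.pi fun _ : Fin n => P)
      = n * ∫ x, Z x ∂P := by
    simp only [Finset.sum_apply]
    rw [integral_finsetSum _ fun i _ => (hZi i).integrable (by norm_num)]
    have : ∀ i : Fin n, ∫ x, Z (x i) ∂(Measure.pi fun _ : Fin n => P) = ∫ x, Z x ∂P := fun i => by
      have hmp := measurePreserving_eval (fun _ : Fin n => P) i
      conv_rhs => rw [← hmp.map_eq]
      rw [integral_map hmp.measurable.aemeasurable
        (by rw [hmp.map_eq]; exact hZ.aestronglyMeasurable)]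
    simp [this]
  calc _ ≤ (Measure.pi fun _ : Fin n => P) {x | C * (n * ε ^ 2) ≤
          |(∑ i, fun x : Fin n → X => Z (x i)) x - ∫ x, (∑ i, fun x : Fin n → X => Z (x i)) x
            ∂(Measure.pi fun _ : Fin n => P)|} := by
        refine measure_mono fun x hx => ?_
        simp only [Set.mem_ofPred_eq] at hx ⊢
        rw [hES, Finset.sum_apply, le_abs]
        right
        nlinarith
    _ ≤ ENNReal.ofReal (ProbabilityTheory.variance (∑ i, fun x : Fin n → X => Z (x i))
          (Measure.pi fun _ => P) / (C * (n * ε ^ 2)) ^ 2) :=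
        ProbabilityTheory.meas_ge_le_variance_div_sq hS hc
    _ ≤ ENNReal.ofReal (1 / (C ^ 2 * (n * ε ^ 2))) := by
        refine ENNReal.ofReal_le_ofReal ?_
        calc _ ≤ (n * ε ^ 2) / (C * (n * ε ^ 2)) ^ 2 := by gcongr
          _ = 1 / (C ^ 2 * (n * ε ^ 2)) := by field_simp

/-- By Jensen's inequality the logarithm of the evidence is at least the sum over the observations of
`Z = ∫ log r_θ dν`, whose mean and second moment inherit the bounds on those of `log r_θ`. -/
lemma measure_evidence_lt_le_of_isProbabilityMeasure {P : Measure X} [IsProbabilityMeasure P]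
    {r : Θ → X → ℝ≥0∞} (hr : Measurable (Function.uncurry r))
    (ν : Measure Θ) [IsProbabilityMeasure ν] {ε : ℝ} (hε : 0 < ε)
    (hpos : ∀ᵐ θ ∂ν, ∀ᵐ x ∂P, r θ x ≠ 0 ∧ r θ x ≠ ∞)
    (hsq : ∀ᵐ θ ∂ν, ∫⁻ x, ENNReal.ofReal (Real.log (r θ x).toReal ^ 2) ∂P ≤ ENNReal.ofReal (ε ^ 2))
    (hmean : ∀ᵐ θ ∂ν, -ε ^ 2 ≤ ∫ x, Real.log (r θ x).toReal ∂P)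
    {n : ℕ} (hn : 0 < n) {C : ℝ} (hC : 0 < C) :
    (Measure.pi fun _ : Fin n => P) {x | ∫⁻ θ, ∏ i, r θ (x i) ∂ν <
        ENNReal.ofReal (Real.exp (-((1 + C) * (n * ε ^ 2))))}
      ≤ ENNReal.ofReal (1 / (C ^ 2 * (n * ε ^ 2))) := by
  let l : Θ → X → ℝ := fun θ x => Real.log (r θ x).toReal
  have hl : Measurable (Function.uncurry l) := Real.measurable_log.comp hr.ennreal_toReal
  have hl2 : Integrable (fun z : Θ × X => l z.1 z.2 ^ 2) (ν.prod P) := by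
    refine ⟨(hl.pow_const 2).aestronglyMeasurable, ?_⟩
    rw [hasFiniteIntegral_iff_ofReal (Eventually.of_forall fun z => sq_nonneg _),
      lintegral_prod (fun z : Θ × X => ENNReal.ofReal (l z.1 z.2 ^ 2))
        (hl.pow_const 2).ennreal_ofReal.aemeasurable]
    calc _ ≤ ∫⁻ _, ENNReal.ofReal (ε ^ 2) ∂ν := lintegral_mono_ae hsq
      _ < ∞ := by simp
  have hlmem : MemLp (Function.uncurry l) 2 (ν.prod P) :=
    (memLp_two_iff_integrable_sq hl.aestronglyMeasurable).2 hl2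
  have hl1 : Integrable (Function.uncurry l) (ν.prod P) := hlmem.integrable (by norm_num)
  let Z : X → ℝ := fun x => ∫ θ, l θ x ∂ν
  have hZsq : ∀ᵐ x ∂P, Z x ^ 2 ≤ ∫ θ, l θ x ^ 2 ∂ν := by
    filter_upwards [hl2.prod_left_ae] with x hx
    have hm : MemLp (fun θ => l θ x) 2 ν := (memLp_two_iff_integrable_sq
      (hl.comp measurable_prodMk_right).aestronglyMeasurable).2 hx
    have := ProbabilityTheory.variance_nonneg (fun θ => l θ x) ν
    rw [ProbabilityTheory.variance_eq_sub hm] at this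
    simpa using this
  have hZm : AEStronglyMeasurable Z P := hl1.integral_prod_right.aestronglyMeasurable
  have hZ2 : Integrable (fun x => Z x ^ 2) P :=
    hl2.integral_prod_right.mono' (hZm.pow 2) (by
      filter_upwards [hZsq] with x hx
      rwa [Real.norm_of_nonneg (sq_nonneg _)])
  have hZ : MemLp Z 2 P := (memLp_two_iff_integrable_sq hZm).2 hZ2
  have hEZ : -ε ^ 2 ≤ ∫ x, Z x ∂P := by
    rw [← integral_integral_swap (f := l) hl1]
    calc -ε ^ 2 = ∫ _, -ε ^ 2 ∂ν := by simp
      _ ≤ _ := integral_mono_ae (integrable_const _) hl1.integral_prod_left hmean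
  have hEZ2 : ∫ x, Z x ^ 2 ∂P ≤ ε ^ 2 := by
    calc ∫ x, Z x ^ 2 ∂P ≤ ∫ x, ∫ θ, l θ x ^ 2 ∂ν ∂P :=
          integral_mono_ae hZ2 hl2.integral_prod_right hZsq
      _ = ∫ θ, ∫ x, l θ x ^ 2 ∂P ∂ν :=
          (integral_integral_swap (f := fun θ x => l θ x ^ 2) hl2).symm
      _ ≤ ∫ _, ε ^ 2 ∂ν := by
          refine integral_mono_ae hl2.integral_prod_left (integrable_const _) ?_
          filter_upwards [hsq] with θ hθ
          rw [integral_eq_lintegral_of_nonneg_ae (f := fun x => l θ x ^ 2)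
            (Eventually.of_forall fun x => sq_nonneg _)
            ((hl.comp measurable_prodMk_left).pow_const 2).aestronglyMeasurable]
          exact ENNReal.toReal_le_of_le_ofReal (sq_nonneg _) hθ
      _ = ε ^ 2 := by simp
  have hpos' : ∀ᵐ x ∂P, ∀ᵐ θ ∂ν, r θ x ≠ 0 ∧ r θ x ≠ ∞ := by
    rwa [← Measure.ae_ae_comm]
    exact (hr (measurableSet_singleton 0).compl).inter (hr (measurableSet_singleton ∞).compl)
  refine le_trans (measure_mono_ae ?_) (measure_sum_lt_le hZ hε hEZ hEZ2 hn hC)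
  filter_upwards [ae_forall_apply hpos' n, ae_forall_apply hl1.prod_left_ae n] with x hx hxi hlt
  have hxpos : ∀ᵐ θ ∂ν, ∀ i, r θ (x i) ≠ 0 ∧ r θ (x i) ≠ ∞ := ae_all_iff.2 hx
  have hexp : ∫⁻ θ, ∏ i, r θ (x i) ∂ν = ∫⁻ θ, ENNReal.ofReal (Real.exp (∑ i, l θ (x i))) ∂ν := by
    refine lintegral_congr_ae ?_
    filter_upwards [hxpos] with θ hθ
    rw [Real.exp_sum, ENNReal.ofReal_prod_of_nonneg fun i _ => (Real.exp_pos _).le]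
    refine Finset.prod_congr rfl fun i _ => ?_
    rw [Real.exp_log (ENNReal.toReal_pos (hθ i).1 (hθ i).2), ENNReal.ofReal_toReal (hθ i).2]
  have hjensen := ofReal_exp_integral_le (ν := ν) (g := fun θ => ∑ i, l θ (x i))
    (integrable_finsetSum _ fun i _ => hxi i)
  rw [integral_finsetSum (f := fun i θ => l θ (x i)) _ fun i _ => hxi i, ← hexp] at hjensen
  have := hjensen.trans_lt hlt
  rw [ENNReal.ofReal_lt_ofReal_iff (Real.exp_pos _), Real.exp_lt_exp] at this
  exact this

/-- The evidence is at least `π(B) exp (-(1 + C) n ε²)` with high probability if the logarithms of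
the ratios indexed by `B` have mean at least `-ε²` and second moment at most `ε²`. -/
lemma measure_evidence_lt_le {P : Measure X} [IsProbabilityMeasure P]
    {r : Θ → X → ℝ≥0∞} (hr : Measurable (Function.uncurry r))
    (π : Measure Θ) [IsFiniteMeasure π] {B : Set Θ} (hB : MeasurableSet B) (hπB : π B ≠ 0)
    {ε : ℝ} (hε : 0 < ε)
    (hpos : ∀ θ ∈ B, ∀ᵐ x ∂P, r θ x ≠ 0 ∧ r θ x ≠ ∞)
    (hsq : ∀ θ ∈ B, ∫⁻ x, ENNReal.ofReal (Real.log (r θ x).toReal ^ 2) ∂P ≤ ENNReal.ofReal (ε ^ 2))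
    (hmean : ∀ θ ∈ B, -ε ^ 2 ≤ ∫ x, Real.log (r θ x).toReal ∂P)
    {n : ℕ} (hn : 0 < n) {C : ℝ} (hC : 0 < C) :
    (Measure.pi fun _ : Fin n => P) {x | ∫⁻ θ, ∏ i, r θ (x i) ∂π <
        π B * ENNReal.ofReal (Real.exp (-((1 + C) * (n * ε ^ 2))))}
      ≤ ENNReal.ofReal (1 / (C ^ 2 * (n * ε ^ 2))) := by
  have hfin : π B ≠ ∞ := measure_ne_top π B
  have : IsProbabilityMeasure (ProbabilityTheory.cond π B) :=
    ProbabilityTheory.cond_isProbabilityMeasure hπB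
  have hae : ∀ {q : Θ → Prop}, (∀ θ ∈ B, q θ) → ∀ᵐ θ ∂(ProbabilityTheory.cond π B), q θ :=
    fun h => (ProbabilityTheory.ae_cond_mem hB).mono fun θ hθ => h θ hθ
  refine le_trans (measure_mono fun x hx => ?_)
    (measure_evidence_lt_le_of_isProbabilityMeasure hr (ProbabilityTheory.cond π B) hε
      (hae hpos) (hae hsq) (hae hmean) hn hC)
  simp only [Set.mem_ofPred_eq] at hx ⊢
  rw [ProbabilityTheory.cond, lintegral_smul_measure, smul_eq_mul]
  have h1 := (setLIntegral_le_lintegral B fun θ => ∏ i, r θ (x i)).trans_lt hx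
  rw [mul_comm, ← div_eq_mul_inv, ENNReal.div_lt_iff (Or.inl hπB) (Or.inl hfin), mul_comm]
  exact h1

/-- The extended-real conditions of `klNeighborhood` in terms of real logarithms: a finite second
moment forces the ratio to be positive and finite almost surely. -/
lemma log_moments_of_extIntegral_le {P : Measure X} [IsProbabilityMeasure P] {g : X → ℝ≥0∞}
    (hg : Measurable g) {ε : ℝ}
    (h₁ : -extIntegral P (fun x => ENNReal.log (g x)) ≤ ((ε ^ 2 : ℝ) : EReal))
    (h₂ : extIntegral P (fun x => ENNReal.log (g x) ^ 2) ≤ ((ε ^ 2 : ℝ) : EReal)) :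
    (∀ᵐ x ∂P, g x ≠ 0 ∧ g x ≠ ∞) ∧
      ∫⁻ x, ENNReal.ofReal (Real.log (g x).toReal ^ 2) ∂P ≤ ENNReal.ofReal (ε ^ 2) ∧
      -ε ^ 2 ≤ ∫ x, Real.log (g x).toReal ∂P := by
  have hlog : Measurable fun x => ENNReal.log (g x) := ENNReal.measurable_log.comp hg
  have hsq : Measurable fun x => (ENNReal.log (g x) ^ 2).toENNReal :=
    measurable_ereal_toENNReal.comp (hlog.pow_const 2)
  have hnn : ∀ x, 0 ≤ ENNReal.log (g x) ^ 2 := fun x => by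
    induction ENNReal.log (g x) with
    | bot => simp [sq]
    | coe y => exact_mod_cast sq_nonneg y
    | top => simp [sq]
  have hb : ∫⁻ x, (ENNReal.log (g x) ^ 2).toENNReal ∂P ≤ ENNReal.ofReal (ε ^ 2) := by
    unfold extIntegral at h₂
    have h0 : ∫⁻ x, (-(ENNReal.log (g x) ^ 2)).toENNReal ∂P = 0 := by
      simp [EReal.toENNReal_of_nonpos, hnn]
    rw [h0] at h₂
    simp only [EReal.coe_ennreal_zero, sub_zero] at h₂
    rw [← EReal.coe_ennreal_le_coe_ennreal_iff, EReal.coe_ennreal_ofReal,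
      max_eq_left (sq_nonneg ε)]
    exact h₂
  have hpos : ∀ᵐ x ∂P, g x ≠ 0 ∧ g x ≠ ∞ := by
    filter_upwards [ae_lt_top hsq (hb.trans_lt ENNReal.ofReal_lt_top).ne] with x hx
    constructor <;> intro h <;> simp [h, sq] at hx
  have hlogr : ∀ᵐ x ∂P, ENNReal.log (g x) = ((Real.log (g x).toReal : ℝ) : EReal) := by
    filter_upwards [hpos] with x hx
    exact ENNReal.log_pos_real hx.1 hx.2
  have hb' : ∫⁻ x, ENNReal.ofReal (Real.log (g x).toReal ^ 2) ∂P ≤ ENNReal.ofReal (ε ^ 2) := by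
    refine le_trans (le_of_eq (lintegral_congr_ae ?_)) hb
    filter_upwards [hlogr] with x hx
    rw [hx, ← EReal.coe_pow, EReal.toENNReal_of_ne_top (EReal.coe_ne_top _), EReal.toReal_coe]
  refine ⟨hpos, hb', ?_⟩
  have hl : Measurable fun x => Real.log (g x).toReal :=
    Real.measurable_log.comp hg.ennreal_toReal
  have hmem : MemLp (fun x => Real.log (g x).toReal) 2 P := by
    refine (memLp_two_iff_integrable_sq hl.aestronglyMeasurable).2
      ⟨(hl.pow_const 2).aestronglyMeasurable, ?_⟩
    rw [hasFiniteIntegral_iff_ofReal (Eventually.of_forall fun z => sq_nonneg _)]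
    exact hb'.trans_lt ENNReal.ofReal_lt_top
  have hint := hmem.integrable (by norm_num)
  have hext : extIntegral P (fun x => ENNReal.log (g x))
      = ((∫ x, Real.log (g x).toReal ∂P : ℝ) : EReal) := by
    have e1 : ∫⁻ x, (ENNReal.log (g x)).toENNReal ∂P
        = ∫⁻ x, ENNReal.ofReal (Real.log (g x).toReal) ∂P := by
      refine lintegral_congr_ae ?_
      filter_upwards [hlogr] with x hx
      rw [hx, EReal.toENNReal_of_ne_top (EReal.coe_ne_top _), EReal.toReal_coe]
    have e2 : ∫⁻ x, (-(ENNReal.log (g x))).toENNReal ∂P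
        = ∫⁻ x, ENNReal.ofReal (-Real.log (g x).toReal) ∂P := by
      refine lintegral_congr_ae ?_
      filter_upwards [hlogr] with x hx
      rw [hx, ← EReal.coe_neg, EReal.toENNReal_of_ne_top (EReal.coe_ne_top _), EReal.toReal_coe]
    have f1 : ∫⁻ x, ENNReal.ofReal (Real.log (g x).toReal) ∂P ≠ ∞ :=
      hint.lintegral_lt_top.ne
    have f2 : ∫⁻ x, ENNReal.ofReal (-Real.log (g x).toReal) ∂P ≠ ∞ :=
      hint.neg.lintegral_lt_top.ne
    rw [extIntegral, e1, e2, integral_eq_lintegral_pos_part_sub_lintegral_neg_part hint,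
      EReal.coe_sub, EReal.coe_ennreal_toReal f1, EReal.coe_ennreal_toReal f2]
  rw [hext, ← EReal.coe_neg, EReal.coe_le_coe_iff] at h₁
  linarith

end

/-! ### The posterior mass of a shell -/

section

variable {X Θ : Type*} [MeasurableSpace X] [MeasurableSpace Θ]

lemma rnDeriv_ae_eq_density {μ P₀ Q : Measure X} [SigmaFinite μ] (hP₀ : P₀ ≪ μ) {q : X → ℝ≥0∞}
    (hq : Measurable q) (hQ : Q = μ.withDensity q) : Q.rnDeriv μ =ᵐ[P₀] q := by
  rw [hQ]
  exact hP₀.ae_le (Measure.rnDeriv_withDensity μ hq)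

lemma density_ne_zero_ne_top {μ P₀ Q : Measure X} [IsProbabilityMeasure Q]
    (hP₀ : P₀ ≪ μ) {q : X → ℝ≥0∞} (hq : Measurable q) (hQ : Q = μ.withDensity q)
    (hac : P₀ ≪ Q) : ∀ᵐ x ∂P₀, q x ≠ 0 ∧ q x ≠ ∞ := by
  have h0 : ∀ᵐ x ∂P₀, q x ≠ 0 := by
    have : ∀ᵐ x ∂Q, q x ≠ 0 := by
      rw [hQ, ae_withDensity_iff hq]
      exact Eventually.of_forall fun x hx => hx
    exact hac.ae_le this
  have hfin : ∫⁻ x, q x ∂μ ≠ ∞ := by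
    have : Q Set.univ = ∫⁻ x, q x ∂μ := by
      rw [hQ, withDensity_apply _ MeasurableSet.univ, Measure.restrict_univ]
    rw [← this]
    finiteness
  filter_upwards [h0, hP₀.ae_le (ae_lt_top hq hfin)] with x h h'
  exact ⟨h, h'.ne⟩

/-- Dividing all densities by a common positive density does not change the posterior. -/
lemma posterior_eq_of_ratio (π : Measure Θ) {p r : Θ → X → ℝ≥0∞} {q : X → ℝ≥0∞}
    (hr : Measurable (Function.uncurry r)) {n : ℕ} {x : Fin n → X}
    (hx : ∀ i, q (x i) ≠ 0 ∧ q (x i) ≠ ∞) (hp : ∀ θ y, r θ y = p θ y / q y) (B : Set Θ) :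
    posterior π p x B = posterior π r x B := by
  have hprod : ∀ θ, ∏ i, p θ (x i) = (∏ i, r θ (x i)) * ∏ i, q (x i) := fun θ => by
    rw [← Finset.prod_mul_distrib]
    refine Finset.prod_congr rfl fun i _ => ?_
    rw [hp, ENNReal.div_mul_cancel (hx i).1 (hx i).2]
  have hm : Measurable fun θ => ∏ i, r θ (x i) :=
    (measurable_prod_apply hr n).comp measurable_prodMk_right
  simp only [posterior, hprod]
  rw [lintegral_mul_const _ hm, lintegral_mul_const _ hm, ENNReal.mul_div_mul_right]
  · exact Finset.prod_ne_zero_iff.2 fun i _ => (hx i).1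
  · exact ENNReal.prod_ne_top fun i _ => (hx i).2

lemma densityRatio_convexCombination {μ P₀ Pstar Q Q' : Measure X} [SigmaFinite μ] (hP₀ : P₀ ≪ μ)
    [IsProbabilityMeasure Q] [IsProbabilityMeasure Q'] (s u : ℝ≥0) :
    densityRatio μ (s • Q + u • Q') Pstar =ᵐ[P₀]
      fun x => (s : ℝ≥0∞) * densityRatio μ Q Pstar x + u * densityRatio μ Q' Pstar x := by
  have h : (s • Q + u • Q').rnDeriv μ =ᵐ[μ] s • Q.rnDeriv μ + u • Q'.rnDeriv μ := by
    filter_upwards [Measure.rnDeriv_add' (s • Q) (u • Q') μ, Measure.rnDeriv_smul_left' Q μ s,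
      Measure.rnDeriv_smul_left' Q' μ u] with x h1 h2 h3
    rw [h1, Pi.add_apply, h2, h3, Pi.add_apply]
  filter_upwards [hP₀.ae_le h] with x hx
  rw [densityRatio, hx]
  simp only [densityRatio, Pi.add_apply, Pi.smul_apply, ENNReal.smul_def, smul_eq_mul,
    div_eq_mul_inv]
  ring

lemma exists_exponent_le_of_le_iSup {P₀ : Measure X} [IsProbabilityMeasure P₀] {g : X → ℝ≥0∞}
    (hg : Measurable g) (hfin : ∫⁻ x, g x ∂P₀ ≠ ∞) {c : ℝ}
    (h : ((c : ℝ) : EReal) ≤ ⨆ α ∈ Set.Ioo (0 : ℝ) 1, -ENNReal.log (∫⁻ x, g x ^ α ∂P₀)) :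
    ∃ a ∈ Set.Icc (0 : ℝ) 1, ∫⁻ x, supportPow a (g x) ∂P₀ ≤ ENNReal.ofReal (Real.exp (-c)) := by
  -- the infimum over the open interval is at least the minimum over the closed one
  obtain ⟨a, ha, hmin⟩ := isCompact_Icc.exists_isMinOn (Set.nonempty_Icc.2 zero_le_one)
    (continuousOn_lintegral_supportPow hg hfin)
  refine ⟨a, ha, ?_⟩
  have hle : ((c : ℝ) : EReal) ≤ -ENNReal.log (∫⁻ x, supportPow a (g x) ∂P₀) := by
    refine h.trans (iSup₂_le fun α hα => ?_)
    rw [EReal.neg_le_neg_iff]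
    refine ENNReal.log_monotone ((hmin (Set.Ioo_subset_Icc_self hα)).trans_eq ?_)
    simp only [supportPow_eq_rpow hα.1]
  rw [EReal.le_neg] at hle
  rw [← ENNReal.log_le_log_iff, ENNReal.log_ofReal_of_pos (Real.exp_pos _), Real.log_exp,
    EReal.coe_neg]
  exact hle

/-- The exponential bound for the numerator of the posterior on a part `A` of the model that is
contained in a testable set. -/
lemma exists_exponent_of_isTestable {μ P₀ Pstar : Measure X} [SigmaFinite μ]
    [IsProbabilityMeasure P₀] (hP₀ : P₀ ≪ μ) {η : ℝ} {B : Set (Measure X)}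
    (hB : IsTestable μ P₀ Pstar η B) {r : Θ → X → ℝ≥0∞} (hr : Measurable (Function.uncurry r))
    {Q : Θ → Measure X} (hrQ : ∀ θ, r θ =ᵐ[P₀] densityRatio μ (Q θ) Pstar)
    (hfin : ∀ θ, ∫⁻ x, r θ x ∂P₀ ≠ ∞) (π : Measure Θ) [IsFiniteMeasure π] {A : Set Θ}
    (hA : ∀ θ ∈ A, Q θ ∈ B) :
    ∃ a ∈ Set.Icc (0 : ℝ) 1, ∀ n : ℕ,
      ∫⁻ x, supportPow a (∫⁻ θ in A, ∏ i, r θ (x i) ∂π) ∂(Measure.pi fun _ : Fin n => P₀)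
        ≤ ENNReal.ofReal (Real.exp (-(η ^ 2 / 4))) ^ n * supportPow a (π A) := by
  obtain ⟨hprob, hcvx, htest⟩ := hB
  let 𝓖 : Set (X → ℝ≥0∞) := {g | Measurable g ∧ ∫⁻ x, g x ∂P₀ ≠ ∞ ∧
    ∃ Q ∈ B, g =ᵐ[P₀] densityRatio μ Q Pstar}
  have hconv : ∀ g ∈ 𝓖, ∀ h ∈ 𝓖, ∀ s u : ℝ≥0, s + u = 1 →
      (fun x => (s : ℝ≥0∞) * g x + u * h x) ∈ 𝓖 := by
    rintro g ⟨hg, hgf, Q, hQ, hgQ⟩ h ⟨hh, hhf, Q', hQ', hhQ⟩ s u hsu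
    have := (hprob Q hQ).1
    have := (hprob Q' hQ').1
    refine ⟨(hg.const_mul _).add (hh.const_mul _), ?_, s • Q + u • Q',
      hcvx hQ hQ' zero_le zero_le hsu, ?_⟩
    · rw [lintegral_add_left (hg.const_mul _), lintegral_const_mul _ hg, lintegral_const_mul _ hh]
      finiteness
    · filter_upwards [hgQ, hhQ, densityRatio_convexCombination (Pstar := Pstar) hP₀ (Q := Q)
        (Q' := Q') s u] with x h1 h2 h3
      rw [h3, h1, h2]
  obtain ⟨a, ha, hav⟩ := exists_uniform_exponent (P := P₀) (𝓖 := 𝓖) (fun g hg => hg.1)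
    (fun g hg => hg.2.1) hconv (v := (Real.exp (-(η ^ 2 / 4))).toNNReal) (by
      rintro g ⟨hg, hgf, Q, hQ, hgQ⟩
      refine exists_exponent_le_of_le_iSup hg hgf (htest.trans ((iInf₂_le Q hQ).trans_eq ?_))
      refine iSup_congr fun α => iSup_congr fun _ => ?_
      congr 2
      refine lintegral_congr_ae ?_
      filter_upwards [hgQ] with x hx
      rw [hx])
  refine ⟨a, ha, fun n => ?_⟩
  obtain ⟨τ, hτ⟩ := exists_map_subtype_val_eq_restrict π A
  have hτA : τ Set.univ = π A := by
    rw [← Set.preimage_univ (f := (Subtype.val : A → Θ)),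
      ← Measure.map_apply measurable_subtype_coe MeasurableSet.univ, hτ,
      Measure.restrict_apply_univ]
  have : IsFiniteMeasure τ := ⟨by rw [hτA]; exact measure_lt_top π A⟩
  have key := lintegral_supportPow_likelihood_le hconv ha.1 hav
    (r := fun (θ : A) => r θ.1) (hr.comp ((measurable_subtype_coe.comp measurable_fst).prodMk
      measurable_snd)) (fun θ => ⟨hr.comp measurable_prodMk_left, hfin θ, Q θ, hA θ θ.2, hrQ θ⟩)
    τ n (h := fun _ => 1) measurable_const
  have hint : ∀ x : Fin n → X, ∫⁻ θ in A, ∏ i, r θ (x i) ∂π = ∫⁻ θ : A, ∏ i, r θ.1 (x i) ∂τ := by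
    intro x
    rw [← hτ, lintegral_map (f := fun θ => ∏ i, r θ (x i))
      ((measurable_prod_apply hr n).comp measurable_prodMk_right) measurable_subtype_coe]
  simp only [mul_one, lintegral_one, hτA] at key
  simp only [hint]
  exact key

/-- Turns a fractional moment bound for the numerator into a bound for the expected posterior mass on
the event that the evidence is at least `δ`. -/
lemma lintegral_posterior_le_of_exponent {P : Measure X} [IsProbabilityMeasure P]
    {r : Θ → X → ℝ≥0∞} (hr : Measurable (Function.uncurry r)) (π : Measure Θ) [IsFiniteMeasure π]
    {A : Set Θ} {n : ℕ} {a : ℝ} (ha : a ∈ Set.Icc (0 : ℝ) 1) {w δ K : ℝ≥0∞}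
    (hA : ∫⁻ x, supportPow a (∫⁻ θ in A, ∏ i, r θ (x i) ∂π) ∂(Measure.pi fun _ : Fin n => P)
      ≤ w * supportPow a (π A))
    (hK : 1 ≤ K) (hπ : π A / δ ≤ K) :
    ∫⁻ x in {x | δ ≤ ∫⁻ θ, ∏ i, r θ (x i) ∂π}, posterior π r x A ∂(Measure.pi fun _ : Fin n => P)
      ≤ w * K := by
  have hD : ∀ B : Set Θ, Measurable fun x : Fin n → X => ∫⁻ θ in B, ∏ i, r θ (x i) ∂π := fun B =>
    Measurable.lintegral_prod_left' (measurable_prod_apply hr n)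
  have hD' : Measurable fun x : Fin n → X => ∫⁻ θ, ∏ i, r θ (x i) ∂π :=
    Measurable.lintegral_prod_left' (measurable_prod_apply hr n)
  calc _ ≤ ∫⁻ x in {x | δ ≤ ∫⁻ θ, ∏ i, r θ (x i) ∂π},
          supportPow a (∫⁻ θ in A, ∏ i, r θ (x i) ∂π) * supportPow a δ⁻¹
            ∂(Measure.pi fun _ : Fin n => P) := by
        refine setLIntegral_mono' (measurableSet_le measurable_const hD') fun x hx => ?_
        rw [← supportPow_mul ha.1]
        refine (le_supportPow ha.2 (ENNReal.div_le_of_le_mul ?_)).trans (supportPow_mono ha.1 ?_)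
        · rw [one_mul]
          exact setLIntegral_le_lintegral _ _
        · rw [← div_eq_mul_inv]
          exact ENNReal.div_le_div_left hx _
    _ ≤ ∫⁻ x, supportPow a (∫⁻ θ in A, ∏ i, r θ (x i) ∂π) * supportPow a δ⁻¹
            ∂(Measure.pi fun _ : Fin n => P) := setLIntegral_le_lintegral _ _
    _ = (∫⁻ x, supportPow a (∫⁻ θ in A, ∏ i, r θ (x i) ∂π) ∂(Measure.pi fun _ : Fin n => P))
          * supportPow a δ⁻¹ := lintegral_mul_const _ ((hD A).supportPow a)
    _ ≤ w * supportPow a (π A) * supportPow a δ⁻¹ := by gcongr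
    _ = w * supportPow a (π A / δ) := by rw [mul_assoc, ← supportPow_mul ha.1, div_eq_mul_inv]
    _ ≤ w * K := by
        gcongr
        exact (supportPow_mono ha.1 hπ).trans (supportPow_le_self ha.2 hK)

lemma exists_cover_of_testingCoveringNumber_le {μ P₀ : Measure X} {𝓜 : Set (Measure X)}
    [PseudoMetricSpace 𝓜] {Pstar : 𝓜} {η : ℝ} {c : ℝ≥0∞} (hc : c ≠ ∞)
    (h : (testingCoveringNumber μ P₀ 𝓜 Pstar η : ℝ≥0∞) ≤ c) :
    ∃ (k : ℕ) (B : Fin k → Set (Measure X)), (k : ℝ≥0∞) ≤ c ∧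
      (∀ i, IsTestable μ P₀ Pstar η (B i)) ∧
      ∀ P : 𝓜, η < dist P Pstar → dist P Pstar < 2 * η → ∃ i, (P : Measure X) ∈ B i := by
  set S : Set ℕ∞ := {N : ℕ∞ | ∃ (k : ℕ) (B : Fin k → Set (Measure X)), N = k ∧
    (∀ i, IsTestable μ P₀ Pstar η (B i)) ∧
    ∀ P : 𝓜, η < dist P Pstar → dist P Pstar < 2 * η → ∃ i, (P : Measure X) ∈ B i} with hS
  have hne : S.Nonempty := by
    by_contra hne
    rw [Set.not_nonempty_iff_eq_empty] at hne
    have : testingCoveringNumber μ P₀ 𝓜 Pstar η = ⊤ := by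
      rw [testingCoveringNumber, ← hS, hne, sInf_empty]
    rw [this] at h
    exact hc (top_le_iff.1 (by simpa using h))
  obtain ⟨k, B, hk, h1, h2⟩ := csInf_mem hne
  refine ⟨k, B, ?_, h1, h2⟩
  have : testingCoveringNumber μ P₀ 𝓜 Pstar η = k := hk
  rw [this] at h
  simpa using h

lemma posterior_le_sum {Y : Type*} (π : Measure Θ) {r : Θ → Y → ℝ≥0∞} {n : ℕ} (x : Fin n → Y)
    {ι : Type*} [Countable ι] {S : Set Θ} {A : ι → Set Θ} (hSA : S ⊆ ⋃ i, A i) :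
    posterior π r x S ≤ ∑' i, posterior π r x (A i) := by
  simp only [posterior, div_eq_mul_inv]
  rw [ENNReal.tsum_mul_right]
  gcongr
  exact (lintegral_mono_set hSA).trans (lintegral_iUnion_le _ _)

lemma measurable_posterior {r : Θ → X → ℝ≥0∞} (hr : Measurable (Function.uncurry r))
    (π : Measure Θ) [IsFiniteMeasure π] (n : ℕ) (A : Set Θ) :
    Measurable fun x : Fin n → X => posterior π r x A :=
  Measurable.div (Measurable.lintegral_prod_left' (measurable_prod_apply hr n))
    (Measurable.lintegral_prod_left' (measurable_prod_apply hr n))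

lemma lintegral_posterior_shell_le {μ P₀ : Measure X} [SigmaFinite μ] [IsProbabilityMeasure P₀]
    (hP₀ : P₀ ≪ μ) {𝓜 : Set (Measure X)} [MeasurableSpace 𝓜] [PseudoMetricSpace 𝓜] {Pstar : 𝓜}
    {r : 𝓜 → X → ℝ≥0∞} (hr : Measurable (Function.uncurry r))
    (hrQ : ∀ θ : 𝓜, r θ =ᵐ[P₀] densityRatio μ θ Pstar) (hfin : ∀ θ, ∫⁻ x, r θ x ∂P₀ ≠ ∞)
    (π : Measure 𝓜) [IsFiniteMeasure π] {η : ℝ} {c δ K : ℝ≥0∞} (hc : c ≠ ∞)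
    (hcover : (testingCoveringNumber μ P₀ 𝓜 Pstar η : ℝ≥0∞) ≤ c) (hK : 1 ≤ K)
    (hπ : π {P : 𝓜 | η < dist P Pstar ∧ dist P Pstar < 2 * η} / δ ≤ K) (n : ℕ) :
    ∫⁻ x in {x | δ ≤ ∫⁻ θ, ∏ i, r θ (x i) ∂π},
        posterior π r x {P : 𝓜 | η < dist P Pstar ∧ dist P Pstar < 2 * η}
        ∂(Measure.pi fun _ : Fin n => P₀)
      ≤ c * (ENNReal.ofReal (Real.exp (-(η ^ 2 / 4))) ^ n * K) := by
  obtain ⟨k, B, hk, htest, hB⟩ := exists_cover_of_testingCoveringNumber_le hc hcover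
  set S := {P : 𝓜 | η < dist P Pstar ∧ dist P Pstar < 2 * η}
  let A : Fin k → Set 𝓜 := fun i => S ∩ {P | (P : Measure X) ∈ B i}
  have hSA : S ⊆ ⋃ i, A i := fun P hP => by
    obtain ⟨i, hi⟩ := hB P hP.1 hP.2
    exact Set.mem_iUnion.2 ⟨i, hP, hi⟩
  have hpiece : ∀ i, ∫⁻ x in {x | δ ≤ ∫⁻ θ, ∏ i, r θ (x i) ∂π}, posterior π r x (A i)
      ∂(Measure.pi fun _ : Fin n => P₀) ≤ ENNReal.ofReal (Real.exp (-(η ^ 2 / 4))) ^ n * K := by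
    intro i
    obtain ⟨a, ha, hav⟩ := exists_exponent_of_isTestable hP₀ (htest i) hr hrQ hfin π (A := A i)
      fun θ hθ => hθ.2
    refine lintegral_posterior_le_of_exponent hr π ha (hav n) hK (le_trans ?_ hπ)
    gcongr
    exact Set.inter_subset_left
  calc _ ≤ ∫⁻ x in {x | δ ≤ ∫⁻ θ, ∏ i, r θ (x i) ∂π}, ∑ i, posterior π r x (A i)
          ∂(Measure.pi fun _ : Fin n => P₀) :=
        lintegral_mono fun x => (posterior_le_sum π x hSA).trans_eq (tsum_fintype _)
    _ = ∑ i, ∫⁻ x in {x | δ ≤ ∫⁻ θ, ∏ i, r θ (x i) ∂π}, posterior π r x (A i)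
          ∂(Measure.pi fun _ : Fin n => P₀) :=
        lintegral_finsetSum _ fun i _ => measurable_posterior hr π n (A i)
    _ ≤ ∑ _i : Fin k, ENNReal.ofReal (Real.exp (-(η ^ 2 / 4))) ^ n * K :=
        Finset.sum_le_sum fun i _ => hpiece i
    _ = k * (ENNReal.ofReal (Real.exp (-(η ^ 2 / 4))) ^ n * K) := by simp
    _ ≤ _ := by gcongr

end

/-! ### The posterior mass of the complement of a ball -/

section

variable {X Θ : Type*} [MeasurableSpace X] [MeasurableSpace Θ]

lemma extIntegral_congr_ae {P : Measure X} {f g : X → EReal} (h : f =ᵐ[P] g) :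
    extIntegral P f = extIntegral P g := by
  have h₁ : ∫⁻ x, (f x).toENNReal ∂P = ∫⁻ x, (g x).toENNReal ∂P :=
    lintegral_congr_ae (h.fun_comp EReal.toENNReal)
  have h₂ : ∫⁻ x, (-f x).toENNReal ∂P = ∫⁻ x, (-g x).toENNReal ∂P :=
    lintegral_congr_ae (h.fun_comp fun y => (-y).toENNReal)
  rw [extIntegral, extIntegral, h₁, h₂]

lemma measurable_extIntegral {P : Measure X} [SFinite P] {f : Θ → X → EReal}
    (hf : Measurable (Function.uncurry f)) : Measurable fun θ => extIntegral P (f θ) :=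
  (Measurable.lintegral_prod_right' (f := fun z : Θ × X => (f z.1 z.2).toENNReal)
      hf.ereal_toENNReal).coe_ereal_ennreal.sub
    (Measurable.lintegral_prod_right' (f := fun z : Θ × X => (-f z.1 z.2).toENNReal)
      hf.neg.ereal_toENNReal).coe_ereal_ennreal

lemma mem_klNeighborhood_iff {μ P₀ : Measure X} {𝓜 : Set (Measure X)} {Pstar θ : 𝓜}
    {g : X → ℝ≥0∞} (hg : g =ᵐ[P₀] densityRatio μ θ Pstar) (ε : ℝ) :
    θ ∈ klNeighborhood μ P₀ 𝓜 Pstar ε ↔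
      -extIntegral P₀ (fun x => ENNReal.log (g x)) ≤ ((ε ^ 2 : ℝ) : EReal) ∧
        extIntegral P₀ (fun x => ENNReal.log (g x) ^ 2) ≤ ((ε ^ 2 : ℝ) : EReal) := by
  have h₁ : extIntegral P₀ (fun x => ENNReal.log (g x)) =
      extIntegral P₀ fun x => ENNReal.log (densityRatio μ θ Pstar x) :=
    extIntegral_congr_ae (hg.fun_comp ENNReal.log)
  have h₂ : extIntegral P₀ (fun x => ENNReal.log (g x) ^ 2) =
      extIntegral P₀ fun x => ENNReal.log (densityRatio μ θ Pstar x) ^ 2 :=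
    extIntegral_congr_ae (hg.fun_comp fun t => ENNReal.log t ^ 2)
  rw [h₁, h₂]
  rfl

lemma measurableSet_klNeighborhood {μ P₀ : Measure X} [IsProbabilityMeasure P₀]
    {𝓜 : Set (Measure X)} [MeasurableSpace 𝓜] {Pstar : 𝓜} {r : 𝓜 → X → ℝ≥0∞}
    (hr : Measurable (Function.uncurry r)) (hrQ : ∀ θ : 𝓜, r θ =ᵐ[P₀] densityRatio μ θ Pstar)
    (ε : ℝ) : MeasurableSet (klNeighborhood μ P₀ 𝓜 Pstar ε) := by
  have hlog : Measurable fun z : 𝓜 × X => ENNReal.log (r z.1 z.2) := ENNReal.measurable_log.comp hr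
  have h₁ := measurable_extIntegral (P := P₀) (f := fun θ x => ENNReal.log (r θ x)) hlog
  have h₂ := measurable_extIntegral (P := P₀) (f := fun θ x => ENNReal.log (r θ x) ^ 2)
    (hlog.pow_const 2)
  convert (measurableSet_le h₁.neg (measurable_const (a := ((ε ^ 2 : ℝ) : EReal)))).inter
    (measurableSet_le h₂ (measurable_const (a := ((ε ^ 2 : ℝ) : EReal)))) using 1
  ext θ
  exact mem_klNeighborhood_iff (hrQ θ) ε

/-- Consecutive shells overlap from radius `2 * ε` on, so their strict inequalities lose no point. -/
lemma le_dist_subset_iUnion_shell {T : Type*} [PseudoMetricSpace T] {t₀ : T} {ε M : ℝ} (hε : 0 < ε)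
    {J : ℕ} (hJ : 2 ≤ J) (hM : (J : ℝ) + 1 ≤ M) :
    {t : T | M * ε ≤ dist t t₀} ⊆ ⋃ m : ℕ,
      {t : T | ((m + J : ℕ) : ℝ) * ε < dist t t₀ ∧ dist t t₀ < 2 * (((m + J : ℕ) : ℝ) * ε)} := by
  intro t ht
  have ht' : M ≤ dist t t₀ / ε := (le_div_iff₀ hε).2 ht
  set y := dist t t₀ / ε with hy
  have hyd : dist t t₀ = y * ε := by rw [hy, div_mul_cancel₀ _ hε.ne']
  have hy0 : (0 : ℝ) ≤ y := by positivity
  have hceil : J + 1 ≤ ⌈y⌉₊ := by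
    have : ((J + 1 : ℕ) : ℝ) ≤ ⌈y⌉₊ := by push_cast; linarith [Nat.le_ceil y]
    exact_mod_cast this
  obtain ⟨m, hm⟩ := Nat.exists_eq_add_of_le hceil
  have h1 : y ≤ (m + J : ℕ) + 1 := by
    have := Nat.le_ceil y
    rw [hm] at this
    push_cast at this ⊢
    linarith
  have h2 : ((m + J : ℕ) : ℝ) < y := by
    have := Nat.ceil_lt_add_one hy0
    rw [hm] at this
    push_cast at this ⊢
    linarith
  have h3 : y < 2 * (m + J : ℕ) := by
    have : (2 : ℝ) ≤ (m + J : ℕ) := by exact_mod_cast (by omega : 2 ≤ m + J)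
    linarith
  refine Set.mem_iUnion.2 ⟨m, ?_, ?_⟩
  · rw [hyd]; gcongr
  · rw [hyd, ← mul_assoc]; gcongr

/-- The nonasymptotic form of the theorem. -/
lemma lintegral_posterior_le {μ P₀ : Measure X} [SigmaFinite μ] [IsProbabilityMeasure P₀]
    (hP₀ : P₀ ≪ μ) {𝓜 : Set (Measure X)} [MeasurableSpace 𝓜] [PseudoMetricSpace 𝓜] {Pstar : 𝓜}
    {r : 𝓜 → X → ℝ≥0∞} (hr : Measurable (Function.uncurry r))
    (hrQ : ∀ θ : 𝓜, r θ =ᵐ[P₀] densityRatio μ θ Pstar) (hfin : ∀ θ, ∫⁻ x, r θ x ∂P₀ ≠ ∞)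
    (π : Measure 𝓜) [IsProbabilityMeasure π] {ε : ℝ} (hε : 0 < ε) {n : ℕ} (hn : 0 < n)
    (hprior : ∀ j : ℕ, 1 ≤ j → π {P : 𝓜 | j * ε < dist P Pstar ∧ dist P Pstar < 2 * j * ε} /
        π (klNeighborhood μ P₀ 𝓜 Pstar ε) ≤ ENNReal.ofReal (Real.exp (n * ε ^ 2 * j ^ 2 / 8)))
    (hentropy : ∀ η : ℝ, ε < η → (testingCoveringNumber μ P₀ 𝓜 Pstar η : ℝ≥0∞)
        ≤ ENNReal.ofReal (Real.exp (n * ε ^ 2)))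
    {c : ℝ} (hc : 0 < c) (hcn : c ≤ n * ε ^ 2) {C : ℝ} (hC : 0 < C) {J : ℕ} (hJ : 16 + C ≤ J)
    {M : ℝ} (hM : (J : ℝ) + 1 ≤ M) :
    ∫⁻ x, posterior π r x {P : 𝓜 | M * ε ≤ dist P Pstar} ∂(Measure.pi fun _ : Fin n => P₀)
      ≤ ENNReal.ofReal (1 / (C ^ 2 * c)) + ∑' m : ℕ, ENNReal.ofReal (Real.exp (-c)) ^ (m + J) := by
  set e : ℝ := n * ε ^ 2 with he
  set b := π (klNeighborhood μ P₀ 𝓜 Pstar ε) with hb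
  have hJ1 : 2 ≤ J := by
    have : (2 : ℝ) ≤ J := by linarith
    exact_mod_cast this
  have hJ2 : ∀ m : ℕ, 16 + C ≤ ((m + J : ℕ) : ℝ) := fun m => by
    push_cast
    linarith [(Nat.cast_nonneg m : (0 : ℝ) ≤ m)]
  let S : ℕ → Set 𝓜 := fun m => {P | ((m + J : ℕ) : ℝ) * ε < dist P Pstar ∧
    dist P Pstar < 2 * (((m + J : ℕ) : ℝ) * ε)}
  have hcov := le_dist_subset_iUnion_shell (t₀ := Pstar) hε hJ1 hM
  have hprior' : ∀ m, π (S m) / b ≤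
      ENNReal.ofReal (Real.exp (e * ((m + J : ℕ) : ℝ) ^ 2 / 8)) := fun m => by
    have := hprior (m + J) (by omega)
    simpa only [S, mul_assoc] using this
  rcases eq_or_ne b 0 with hb0 | hb0
  · -- the prior condition then says that the shells are null sets
    have hS : ∀ m, π (S m) = 0 := fun m => by
      by_contra hne
      have := hprior' m
      rw [hb0, ENNReal.div_zero hne] at this
      exact ENNReal.ofReal_ne_top (top_le_iff.1 this)
    have hnull : π {P : 𝓜 | M * ε ≤ dist P Pstar} = 0 :=
      measure_mono_null hcov (measure_iUnion_null hS)
    have : ∀ x : Fin n → X, posterior π r x {P : 𝓜 | M * ε ≤ dist P Pstar} = 0 := fun x => by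
      rw [posterior, setLIntegral_measure_zero _ _ hnull, ENNReal.zero_div]
    simp [this]
  set δ := b * ENNReal.ofReal (Real.exp (-((1 + C) * e))) with hδ
  let G : Set (Fin n → X) := {x | δ ≤ ∫⁻ θ, ∏ i, r θ (x i) ∂π}
  have hG : MeasurableSet G := measurableSet_le measurable_const
    (Measurable.lintegral_prod_left' (measurable_prod_apply hr n))
  have hGc : (Measure.pi fun _ : Fin n => P₀) Gᶜ ≤ ENNReal.ofReal (1 / (C ^ 2 * c)) := by
    have hkl : ∀ θ ∈ klNeighborhood μ P₀ 𝓜 Pstar ε, _ := fun θ hθ =>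
      log_moments_of_extIntegral_le (P := P₀) (g := r θ) (ε := ε)
        (hr.comp measurable_prodMk_left) ((mem_klNeighborhood_iff (hrQ θ) ε).1 hθ).1
        ((mem_klNeighborhood_iff (hrQ θ) ε).1 hθ).2
    have := measure_evidence_lt_le (P := P₀) hr π (measurableSet_klNeighborhood hr hrQ ε) hb0 hε
      (fun θ hθ => (hkl θ hθ).1) (fun θ hθ => (hkl θ hθ).2.1) (fun θ hθ => (hkl θ hθ).2.2) hn hC
    refine le_trans (measure_mono fun x hx => ?_) (this.trans (ENNReal.ofReal_le_ofReal ?_))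
    · exact not_le.1 (show ¬δ ≤ _ from hx)
    · gcongr
  have hle1 : ∀ (x : Fin n → X) B, posterior π r x B ≤ 1 := fun x B =>
    ENNReal.div_le_of_le_mul (by rw [one_mul]; exact setLIntegral_le_lintegral _ _)
  have hshell : ∀ m, ∫⁻ x in G, posterior π r x (S m) ∂(Measure.pi fun _ : Fin n => P₀)
      ≤ ENNReal.ofReal (Real.exp (-c)) ^ (m + J) := by
    intro m
    set j : ℝ := ((m + J : ℕ) : ℝ) with hj
    have hj16 : 16 + C ≤ j := hJ2 m
    have he0 : 0 < e := hc.trans_le hcn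
    have hjε : ε < j * ε := by nlinarith
    have hπS : π (S m) / δ ≤ ENNReal.ofReal (Real.exp (e * j ^ 2 / 8 + (1 + C) * e)) := by
      rw [hδ, div_eq_mul_inv, ENNReal.mul_inv (Or.inl hb0) (Or.inr (by positivity)), ← mul_assoc,
        ← ENNReal.ofReal_inv_of_pos (Real.exp_pos _), ← Real.exp_neg, neg_neg, Real.exp_add,
        ENNReal.ofReal_mul (Real.exp_pos _).le, ← div_eq_mul_inv]
      gcongr
      exact hprior' m
    have hK : 1 ≤ ENNReal.ofReal (Real.exp (e * j ^ 2 / 8 + (1 + C) * e)) := by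
      rw [ENNReal.one_le_ofReal, Real.one_le_exp_iff]
      positivity
    refine (lintegral_posterior_shell_le hP₀ hr hrQ hfin π ENNReal.ofReal_ne_top
      (hentropy (j * ε) hjε) hK hπS n).trans ?_
    rw [← ENNReal.ofReal_pow (Real.exp_pos _).le, ← ENNReal.ofReal_pow (Real.exp_pos _).le,
      ← Real.exp_nat_mul, ← Real.exp_nat_mul, ← ENNReal.ofReal_mul (Real.exp_pos _).le,
      ← ENNReal.ofReal_mul (Real.exp_pos _).le, ← Real.exp_add, ← Real.exp_add, ← hj]
    refine ENNReal.ofReal_le_ofReal (Real.exp_le_exp.2 ?_)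
    -- the exponent is `e * (2 + C - j ^ 2 / 8)` and `j ^ 2 / 8 ≥ 2 * j ≥ 2 + C + j`
    calc _ = e * (2 + C - j ^ 2 / 8) := by rw [he]; ring
      _ ≤ e * (-j) := by
          gcongr
          nlinarith
      _ ≤ c * (-j) := by nlinarith
      _ = j * -c := by ring
  calc _ = (∫⁻ x in Gᶜ, posterior π r x {P : 𝓜 | M * ε ≤ dist P Pstar}
            ∂(Measure.pi fun _ : Fin n => P₀)) +
          ∫⁻ x in G, posterior π r x {P : 𝓜 | M * ε ≤ dist P Pstar}
            ∂(Measure.pi fun _ : Fin n => P₀) := by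
        rw [add_comm, lintegral_add_compl _ hG]
    _ ≤ (∫⁻ _ in Gᶜ, 1 ∂(Measure.pi fun _ : Fin n => P₀)) +
          ∫⁻ x in G, ∑' m, posterior π r x (S m) ∂(Measure.pi fun _ : Fin n => P₀) := by
        gcongr with x x
        · exact hle1 x _
        · exact posterior_le_sum π x hcov
    _ = (Measure.pi fun _ : Fin n => P₀) Gᶜ +
          ∑' m, ∫⁻ x in G, posterior π r x (S m) ∂(Measure.pi fun _ : Fin n => P₀) := by
        rw [setLIntegral_one, lintegral_tsum fun m => (measurable_posterior hr π n _).aemeasurable]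
    _ ≤ _ := add_le_add hGc (ENNReal.tsum_le_tsum hshell)

end

end Misspecified

theorem theorem2p2 {X : Type*} [MeasurableSpace X]
    -- the dominating measure and the true distribution
    (μ : Measure X) [SigmaFinite μ] (P₀ : Measure X) [IsProbabilityMeasure P₀] (hP₀ : P₀ ≪ μ)
    -- the model, with an arbitrary sigma-field and an arbitrary semi-metric
    (𝓜 : Set (Measure X)) (h𝓜 : ∀ P ∈ 𝓜, IsProbabilityMeasure P)
    [𝓕 : MeasurableSpace 𝓜] [d : PseudoMetricSpace 𝓜]
    -- jointly measurable densities
    (p : 𝓜 → X → ℝ≥0∞) (hp : Measurable (Function.uncurry p))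
    (hdens : ∀ P : 𝓜, (P : Measure X) = μ.withDensity (p P))
    -- the prior
    (π : Measure 𝓜) [IsProbabilityMeasure π]
    (Pstar : 𝓜) (hd : Measurable fun P : 𝓜 => dist P Pstar)
    (hKL : InformationTheory.klDiv P₀ Pstar < ⊤)
    (hratio : ∀ P : 𝓜, ∫⁻ x, Misspecified.densityRatio μ P Pstar x ∂P₀ < ⊤)
    (ε : ℕ → ℝ) (hε_pos : ∀ n, 0 < ε n) (hε : Tendsto ε atTop (𝓝 0))
    (hliminf : 0 < liminf (fun n : ℕ => ((n * ε n ^ 2 : ℝ) : EReal)) atTop)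
    (hprior : ∀ n j : ℕ, 1 ≤ n → 1 ≤ j →
      π {P : 𝓜 | j * ε n < dist P Pstar ∧ dist P Pstar < 2 * j * ε n} /
          π (Misspecified.klNeighborhood μ P₀ 𝓜 Pstar (ε n))
        ≤ ENNReal.ofReal (Real.exp (n * ε n ^ 2 * j ^ 2 / 8)))
    (hentropy : ∀ n : ℕ, 1 ≤ n → ∀ η : ℝ, ε n < η →
      (Misspecified.testingCoveringNumber μ P₀ 𝓜 Pstar η : ℝ≥0∞)
        ≤ ENNReal.ofReal (Real.exp (n * ε n ^ 2)))
    (M : ℕ → ℝ) (hM : Tendsto M atTop atTop) :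
    Tendsto (fun n : ℕ =>
      ∫⁻ x, Misspecified.posterior π p x {P : 𝓜 | M n * ε n ≤ dist P Pstar}
        ∂(Measure.pi fun _ : Fin n => P₀)) atTop (𝓝 0) := by
  let r : 𝓜 → X → ℝ≥0∞ := fun θ x => p θ x / p Pstar x
  have hpθ : ∀ θ, Measurable (p θ) := fun θ => hp.comp measurable_prodMk_left
  have hr : Measurable (Function.uncurry r) := hp.div ((hpθ Pstar).comp measurable_snd)
  have hrQ : ∀ θ : 𝓜, r θ =ᵐ[P₀] Misspecified.densityRatio μ θ Pstar := fun θ => by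
    filter_upwards [Misspecified.rnDeriv_ae_eq_density hP₀ (hpθ θ) (hdens θ),
      Misspecified.rnDeriv_ae_eq_density hP₀ (hpθ Pstar) (hdens Pstar)] with x h h'
    rw [Misspecified.densityRatio, h, h']
  have hfin : ∀ θ, ∫⁻ x, r θ x ∂P₀ ≠ ∞ := fun θ => by
    rw [lintegral_congr_ae (hrQ θ)]
    exact (hratio θ).ne
  have hstar : ∀ᵐ x ∂P₀, p Pstar x ≠ 0 ∧ p Pstar x ≠ ∞ := by
    have := h𝓜 Pstar Pstar.2
    exact Misspecified.density_ne_zero_ne_top hP₀ (hpθ Pstar) (hdens Pstar)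
      (InformationTheory.klDiv_ne_top_iff.1 hKL.ne).1
  obtain ⟨c, hc₀, hcl⟩ := EReal.lt_iff_exists_real_btwn.1 hliminf
  have hc : 0 < c := by exact_mod_cast hc₀
  have hcn : ∀ᶠ n : ℕ in atTop, c ≤ n * ε n ^ 2 := by
    filter_upwards [eventually_lt_of_lt_liminf hcl] with n hn
    exact (EReal.coe_lt_coe_iff.1 hn).le
  rw [ENNReal.tendsto_nhds_zero]
  intro κ hκ
  -- a constant `C` for which the evidence bound fails with probability at most `κ / 2`
  have hC : ∀ᶠ C : ℝ in atTop, ENNReal.ofReal (1 / (C ^ 2 * c)) ≤ κ / 2 := by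
    have h1 : Tendsto (fun C : ℝ => 1 / (C ^ 2 * c)) atTop (𝓝 0) :=
      ((tendsto_pow_atTop two_ne_zero).atTop_mul_const hc).const_div_atTop 1
    have h2 := ENNReal.tendsto_ofReal h1
    rw [ENNReal.ofReal_zero] at h2
    exact h2.eventually_le_const (ENNReal.half_pos hκ.ne')
  obtain ⟨C, hCκ, hC₀⟩ := (hC.and (eventually_gt_atTop 0)).exists
  -- and an index `J` beyond which the shells contribute at most `κ / 2`
  have hsum : ∑' m : ℕ, ENNReal.ofReal (Real.exp (-c)) ^ m ≠ ∞ := by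
    rw [ENNReal.tsum_geometric]
    refine ENNReal.inv_ne_top.2 (tsub_pos_of_lt ?_).ne'
    rw [ENNReal.ofReal_lt_one, Real.exp_lt_one_iff]
    linarith
  have hJ := (ENNReal.tendsto_sum_nat_add _ hsum).eventually_le_const (ENNReal.half_pos hκ.ne')
  obtain ⟨J, hJκ, hJC⟩ := (hJ.and (tendsto_natCast_atTop_atTop.eventually_ge_atTop (16 + C))).exists
  filter_upwards [hcn, hM.eventually_ge_atTop ((J : ℝ) + 1), eventually_gt_atTop 0]
    with n hn hMn hn0
  calc _ = ∫⁻ x, Misspecified.posterior π r x {P : 𝓜 | M n * ε n ≤ dist P Pstar}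
          ∂(Measure.pi fun _ : Fin n => P₀) := by
        refine lintegral_congr_ae ?_
        filter_upwards [Misspecified.ae_forall_apply hstar n] with x hx
        exact Misspecified.posterior_eq_of_ratio π hr hx (fun _ _ => rfl) _
    _ ≤ ENNReal.ofReal (1 / (C ^ 2 * c)) +
          ∑' m : ℕ, ENNReal.ofReal (Real.exp (-c)) ^ (m + J) :=
        Misspecified.lintegral_posterior_le hP₀ hr hrQ hfin π (hε_pos n) hn0
          (fun j hj => hprior n j hn0 hj) (hentropy n hn0) hc hn hC₀ hJC hMn
    _ ≤ κ / 2 + κ / 2 := add_le_add hCκ hJκ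
    _ = κ := ENNReal.add_halves κ
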